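/- Let $\Theta=[0,1]$, and let $d:\Theta\times\Theta\to[0,\infty]$ (in particular, any real-valued such function) be a strong semi-distance function, i.e. $d(p,q)=0$ if and only if $p=q$, $d(p,q)\le d(p,q')$ whenever $p\le q\le q'$, and $d(p,q)\ge d(p',q)$ whenever $p\le p'\le q$. Assume that $d$ is kl-dominated, i.e. $d(p,q)\le d_{kl}(p,q)$ for all $p,q\in\Theta$, where $$d_{kl}(p,q)=p\log\frac pq+(1-p)\log\frac{1-p}{1-q}\in[0,\infty]$$ is the Kullback–Leibler divergence between Bernoulli laws, and that for all $p\in\Theta$ and $\delta>0$ the maximum $\max\{q\in\Theta: d(p,q)\le\delta\}$ is attained. Consider a stochastic bandit with arms $1,\dots,K$ ($K\ge1$): arm $a$ has an arbitrary reward distribution $\nu_a$ on $[0,1]$ with mean $\mu_a$, and all rewards are independent, the successive rewards of arm $a$ having law $\nu_a$. Put $\mu^*=\max_a\mu_a$ and $\Delta_a=\mu^*-\mu_a$. Assume that for every arm $a$ with $\mu_a<\mu^*$ the function $p\mapsto d(p,\mu^*)$ is right-continuous at $\mu_a$. Let $A_t$ be the arm chosen at time $t$, $N_a(t)$ the number of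 times arm $a$ is chosen at the times $1,\dots,t$, and $\bar X_a(t)$ the empirical mean of the rewards obtained from arm $a$ up to time $t$. Let the arms be chosen by the algorithm UCB($d$): $A_t=t$ for $t=1,\dots,K$, and for $t>K$ $$A_t\in\arg\max_{a}\ \max\{q\in\Theta: N_a(t-1)\,d(\bar X_a(t-1),q)\le\log t+3\log\log t\},$$ where ties are broken in any way that depends only on the past choices and rewards and possibly on an independent randomization. (The inner maximum of an empty set, which occurs only for $K=1$, $t=2$, is read as $0$.) Let $R(T)=\mathbb E\big[T\mu^*-\sum_{t=1}^T Y_t\big]$ be the expected regret, where $Y_t$ is the reward received at time $t$. Then $$\limsup_{T\to\infty}\frac{R(T)}{\log T}\le\sum_{a:\mu_a<\mu^*}\frac{\Delta_a}{d(\mu_a,\mu^*)},$$ with the convention $\Delta_a/\infty=0$. -/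

import Mathlib

open MeasureTheory ProbabilityTheory Filter
open scoped unitInterval

/-- A strong semi-distance function on `Θ = [0,1]`. The value `⊤` is permitted, so that the
Bernoulli Kullback-Leibler divergence itself is covered along with all real-valued functions. -/
structure IsStrongSemiDistance (d : I → I → EReal) : Prop where
  nonneg : ∀ p q, 0 ≤ d p q
  eq_zero_iff : ∀ p q, d p q = 0 ↔ p = q
  mono_right : ∀ p q q', p ≤ q → q ≤ q' → d p q ≤ d p q'
  anti_left : ∀ p p' q, p ≤ p' → p' ≤ q → d p' q ≤ d p q

/-- Kullback-Leibler divergence between the Bernoulli laws of means `p` and `q`, with the usual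
conventions `0 log 0 = 0 log (0/0) = 0` and `x log (x/0) = ∞` for `x > 0`. -/
noncomputable def bernoulliKL (p q : I) : EReal :=
  open Classical in
  if (q = 0 ∧ p ≠ 0) ∨ (q = 1 ∧ p ≠ 1) then ⊤
  else (((p : ℝ) * Real.log ((p : ℝ) / q)
    + (1 - (p : ℝ)) * Real.log ((1 - (p : ℝ)) / (1 - (q : ℝ))) : ℝ) : EReal)

/-- `d` is kl-dominated. -/
def IsKLDominated (d : I → I → EReal) : Prop :=
  ∀ p q, d p q ≤ bernoulliKL p q

/-- The problem "maximize `q ∈ [0,1]` subject to `d p q ≤ δ`" has a solution for all `p ∈ [0,1]`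
and all `δ > 0`; this is what makes the maximum in the UCB algorithm meaningful. -/
def HasUpperConfidenceBounds (d : I → I → EReal) : Prop :=
  ∀ (p : I) (δ : ℝ), 0 < δ → ∃ q, IsGreatest {q : I | d p q ≤ (δ : EReal)} q

/-- The expectation of a probability distribution on `[0,1]`, as a point of `[0,1]`. -/
noncomputable def armMean (ν : Measure I) [IsProbabilityMeasure ν] : I :=
  ⟨∫ x, (x : ℝ) ∂ν, integral_nonneg fun x => x.2.1, by
    have h : ∫ x : I, (x : ℝ) ∂ν ≤ ∫ _ : I, (1 : ℝ) ∂ν :=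
      integral_mono_of_nonneg (Eventually.of_forall fun x => x.2.1) (integrable_const _)
        (Eventually.of_forall fun x => x.2.2)
    simpa using h⟩

section Bandit

variable {Ω : Type*} {K : ℕ}

/-- The largest expectation of an arm. -/
noncomputable def bestMean (ν : Fin K → Measure I) [∀ a, IsProbabilityMeasure (ν a)] : I :=
  Finset.univ.sup fun a => armMean (ν a)

/-- `N_a(t)`, the number of times that arm `a` is chosen at the times `1, …, t`. -/
def numPulls (A : ℕ → Ω → Fin K) (a : Fin K) (t : ℕ) (ω : Ω) : ℕ :=
  ((Finset.Icc 1 t).filter fun s => A s ω = a).card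

/-- The reward received at time `t ≥ 1`. `X a i` is the reward of the `(i+1)`-st pull of arm `a`,
so the reward is read at the number of earlier pulls of the arm chosen at time `t`. -/
def reward (X : Fin K → ℕ → Ω → I) (A : ℕ → Ω → Fin K) (t : ℕ) (ω : Ω) : I :=
  X (A t ω) (numPulls A (A t ω) (t - 1) ω) ω

/-- The empirical mean of arm `a` based on the observations up to time `t`
(it is only used when `a` has been pulled). -/
noncomputable def empMean (X : Fin K → ℕ → Ω → I) (A : ℕ → Ω → Fin K) (a : Fin K) (t : ℕ)
    (ω : Ω) : I :=
  ⟨(∑ s ∈ (Finset.Icc 1 t).filter fun s => A s ω = a, (reward X A s ω : ℝ))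
      / (numPulls A a t ω : ℝ),
    div_nonneg (Finset.sum_nonneg fun s _ => (reward X A s ω).2.1) (Nat.cast_nonneg _), by
      refine div_le_one_of_le₀ ?_ (Nat.cast_nonneg _)
      refine (Finset.sum_le_sum fun s _ => (reward X A s ω).2.2).trans ?_
      simp [numPulls]⟩

/-- The upper confidence bound of arm `a` at time `t`: the largest `q ∈ [0,1]` such that
`N_a(t-1) d(X̄_a(t-1), q) ≤ log t + c log log t`. -/
noncomputable def ucbIndex (d : I → I → EReal) (c : ℝ) (X : Fin K → ℕ → Ω → I)
    (A : ℕ → Ω → Fin K) (a : Fin K) (t : ℕ) (ω : Ω) : ℝ :=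
  sSup ((fun q : I => (q : ℝ)) '' {q : I |
    (numPulls A a (t - 1) ω : EReal) * d (empMean X A a (t - 1) ω) q
      ≤ ((Real.log t + c * Real.log (Real.log t) : ℝ) : EReal)})

/-- The information on which the choice at time `t` may depend: the auxiliary randomization `U`
and the choices and rewards at the times `1, …, t - 1`. -/
@[reducible] def past {E : Type*} [MeasurableSpace E] (U : Ω → E) (X : Fin K → ℕ → Ω → I)
    (A : ℕ → Ω → Fin K) (t : ℕ) : MeasurableSpace Ω :=
  MeasurableSpace.comap U inferInstance ⊔
    ⨆ s ∈ Set.Ico 1 t, (MeasurableSpace.comap (A s) inferInstance ⊔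
      MeasurableSpace.comap (reward X A s) inferInstance)

/-- The rewards `X a i` of a stochastic bandit with arms `ν`, and a randomization `U` that is
independent of them: all rewards are independent and `X a i` has law `ν a`. -/
structure IsBanditEnvironment {E : Type*} [MeasurableSpace Ω] [MeasurableSpace E] (P : Measure Ω)
    (ν : Fin K → Measure I) (U : Ω → E) (X : Fin K → ℕ → Ω → I) : Prop where
  measurable_rand : Measurable U
  measurable_reward : ∀ a i, Measurable (X a i)
  law : ∀ a i, P.map (X a i) = ν a
  indep : iIndepFun (fun (k : Fin K × ℕ) => X k.1 k.2) P
  indep_rand : IndepFun U (fun ω (k : Fin K × ℕ) => X k.1 k.2 ω) P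

/-- `A` is a run of the generic algorithm UCB(d) with constant `c`: each choice depends on the past
(and possibly on the independent randomization), the arms are played once each in turn at the times
`1, …, K`, and afterwards an arm of largest upper confidence bound is played (ties may be broken in
any non-anticipating way). -/
structure IsUCB {E : Type*} [MeasurableSpace E] (d : I → I → EReal) (c : ℝ) (U : Ω → E)
    (X : Fin K → ℕ → Ω → I) (A : ℕ → Ω → Fin K) : Prop where
  nonanticipating : ∀ t, 1 ≤ t → Measurable[past U X A t] (A t)
  init : ∀ (a : Fin K) (ω : Ω), A ((a : ℕ) + 1) ω = a
  argmax : ∀ t, K < t → ∀ (ω : Ω) (b : Fin K),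
    ucbIndex d c X A b t ω ≤ ucbIndex d c X A (A t ω) t ω

/-- The expected regret at horizon `T`: the expectation of `T μ* - ∑_{t=1}^T (reward at t)`. -/
noncomputable def regret [MeasurableSpace Ω] (P : Measure Ω) (ν : Fin K → Measure I)
    [∀ a, IsProbabilityMeasure (ν a)] (X : Fin K → ℕ → Ω → I) (A : ℕ → Ω → Fin K) (T : ℕ) : ℝ :=
  ∫ ω, ((T : ℝ) * (bestMean ν : ℝ) - ∑ t ∈ Finset.Icc 1 T, (reward X A t ω : ℝ)) ∂P

end Bandit

/-! By Wald's identity (`regret_eq`) the regret is the sum over arms of the gap times the expected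
number of pulls, so it suffices to show that a suboptimal arm `a` is pulled at most `(1/M + o(1))
log T` times on average, for every `M < d(μ_a, μ*)`.

Fix such an `M` and a best arm `b`. Right-continuity gives `r > μ_a` with `M < d(r, μ*)`. When `a`
is pulled after the initial round, either the index of `b` is below `μ*`, or the index of `a` is at
least `μ*`. In the second case monotonicity of `d` leaves two options: the empirical mean of `a`
exceeds `r`, which by Hoeffding happens for finitely many sample sizes on average
(`summable_measure_mean_gt`), or `a` has been pulled at most `explorationRate T / M` times, and this
is the leading term (`mean_ge_or_of_le_ucbIndex`, `numPulls_le_of_isUCB`).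

In the first case kl-domination turns the event into a Bernoulli-divergence deviation of the
empirical mean of `b`, whatever `d` is. Peeling over geometric slices of sample sizes, with Ville's
inequality on each slice, bounds its probability by `O(1 / (t log t))`
(`measure_exists_klReal_gt_le`, `measureReal_underestimation_le`), so these times contribute only
`o(log T)`. Letting `M` increase to `d(μ_a, μ*)` gives the constant. -/

section Deviations

/-! ### Deviation inequalities for means of independent `[0,1]`-valued variables. -/

variable {Ω : Type*} [MeasurableSpace Ω] {P : Measure Ω} [IsProbabilityMeasure P]

/-- The filtration of the strict past of a sequence of random variables. -/
def strictPast {Y : ℕ → Ω → ℝ} (hY : ∀ i, Measurable (Y i)) :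
    Filtration ℕ (inferInstance : MeasurableSpace Ω) where
  seq n := ⨆ i ∈ Set.Iio n, MeasurableSpace.comap (Y i) inferInstance
  mono' _ _ hmn := biSup_mono fun _ hi => lt_of_lt_of_le hi hmn
  le' _ := iSup₂_le fun i _ => (hY i).comap_le

/-- Partial products of independent nonnegative bounded variables of mean one form a martingale. -/
theorem martingale_prod_of_iIndepFun {Z : ℕ → Ω → ℝ} (hZ : ∀ i, Measurable (Z i))
    (hind : iIndepFun Z P) {C : ℝ} (hC : ∀ i ω, |Z i ω| ≤ C) (hmean : ∀ i, ∫ ω, Z i ω ∂P = 1) :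
    Martingale (fun n ω => ∏ i ∈ Finset.range n, Z i ω) (strictPast hZ) P := by
  have hmeas : ∀ n, Measurable[strictPast hZ n] (fun ω => ∏ i ∈ Finset.range n, Z i ω) := by
    intro n
    refine Finset.measurable_prod _ fun i hi => ?_
    refine Measurable.mono (comap_measurable (Z i)) ?_ le_rfl
    exact le_iSup₂_of_le (f := fun i (_ : i ∈ Set.Iio n) =>
      MeasurableSpace.comap (Z i) inferInstance) i (Finset.mem_range.1 hi) le_rfl
  have hbound : ∀ n, ∃ D, ∀ ω, |∏ i ∈ Finset.range n, Z i ω| ≤ D := fun n =>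
    ⟨C ^ n, fun ω => by
      rw [Finset.abs_prod]
      refine (Finset.prod_le_prod (fun i _ => abs_nonneg _) fun i _ => hC i ω).trans ?_
      simp⟩
  have hint : ∀ n, Integrable (fun ω => ∏ i ∈ Finset.range n, Z i ω) P := fun n => by
    obtain ⟨D, hD⟩ := hbound n
    exact Integrable.of_bound ((hmeas n).mono ((strictPast hZ).le n) le_rfl).aestronglyMeasurable D
      (ae_of_all _ hD)
  have hZint : ∀ n, Integrable (Z n) P := fun n =>
    Integrable.of_bound (hZ n).aestronglyMeasurable C (ae_of_all _ (hC n))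
  refine martingale_nat (fun n => (hmeas n).stronglyMeasurable) hint fun n => ?_
  have hprod : (fun ω => ∏ i ∈ Finset.range (n + 1), Z i ω)
      = (fun ω => ∏ i ∈ Finset.range n, Z i ω) * Z n := by
    ext ω; simp [Finset.prod_range_succ]
  have hindep : Indep (MeasurableSpace.comap (Z n) inferInstance) (strictPast hZ n) P := by
    have := indep_iSup_of_disjoint (fun i => (hZ i).comap_le) hind.iIndep
      (S := {n}) (T := Set.Iio n) (by simp)
    simpa [strictPast] using this
  have h1 := condExp_mul_of_stronglyMeasurable_left (m := strictPast hZ n) (μ := P)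
    (hmeas n).stronglyMeasurable (g := Z n) (by rw [← hprod]; exact hint (n + 1)) (hZint n)
  have h2 := condExp_indep_eq (hZ n).comap_le ((strictPast hZ).le n)
    (comap_measurable (Z n)).stronglyMeasurable hindep
  change _ =ᵐ[P] P[(fun ω => ∏ i ∈ Finset.range (n + 1), Z i ω) | strictPast hZ n]
  rw [hprod]
  filter_upwards [h1, h2] with ω h1 h2
  rw [h1, Pi.mul_apply, h2, hmean, mul_one]

/-- Ville's inequality for partial products of independent variables of mean one. -/
theorem measure_exists_prod_ge_le {Z : ℕ → Ω → ℝ} (hZ : ∀ i, Measurable (Z i))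
    (hind : iIndepFun Z P) {C : ℝ} (hC : ∀ i ω, Z i ω ≤ C) (hpos : ∀ i ω, 0 ≤ Z i ω)
    (hmean : ∀ i, ∫ ω, Z i ω ∂P = 1) {c : ℝ} (hc : 0 < c) (t : ℕ) :
    P.real {ω | ∃ n ≤ t, c ≤ ∏ i ∈ Finset.range n, Z i ω} ≤ c⁻¹ := by
  have hmart := martingale_prod_of_iIndepFun hZ hind (C := C)
    (fun i ω => by rw [abs_of_nonneg (hpos i ω)]; exact hC i ω) hmean
  have hnn : ∀ n ω, 0 ≤ ∏ i ∈ Finset.range n, Z i ω := fun n ω =>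
    Finset.prod_nonneg fun i _ => hpos i ω
  lift c to NNReal using hc.le
  have h := maximal_ineq hmart.submartingale (fun n ω => hnn n ω) (ε := c) t
  have hset : {ω | (c : ℝ) ≤ (Finset.range (t + 1)).sup'
        Finset.nonempty_range_add_one fun k => ∏ i ∈ Finset.range k, Z i ω}
      = {ω | ∃ n ≤ t, (c : ℝ) ≤ ∏ i ∈ Finset.range n, Z i ω} := by
    ext ω; simp [Finset.le_sup'_iff]
  rw [hset] at h
  have hE : ∫ ω, ∏ i ∈ Finset.range t, Z i ω ∂P = 1 := by
    have := hmart.setIntegral_eq (Nat.zero_le t) MeasurableSet.univ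
    simpa using this.symm
  have h3 : ∫ ω in {ω | ∃ n ≤ t, (c : ℝ) ≤ ∏ i ∈ Finset.range n, Z i ω},
      ∏ i ∈ Finset.range t, Z i ω ∂P ≤ 1 := by
    rw [← hE]
    exact setIntegral_le_integral (hmart.integrable t) (ae_of_all _ (hnn t))
  have h5 := ENNReal.toReal_mono (by simp) (h.trans (ENNReal.ofReal_le_ofReal h3))
  rw [ENNReal.toReal_mul, ENNReal.coe_toReal, ENNReal.ofReal_one, ENNReal.toReal_one] at h5
  rw [measureReal_def, ← one_div, le_div_iff₀ hc, mul_comm]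
  exact h5

/-- The real-valued expression of the Bernoulli Kullback-Leibler divergence. -/
noncomputable def klReal (p q : ℝ) : ℝ :=
  p * Real.log (p / q) + (1 - p) * Real.log ((1 - p) / (1 - q))

theorem measurable_klReal (q : ℝ) : Measurable fun p => klReal p q := by
  unfold klReal; fun_prop

/-- In entropy form, convexity and continuity in `p` are inherited from `Real.binEntropy`, with the
endpoints `p = 0, 1` included. -/
theorem klReal_eq {q : ℝ} (h0 : 0 < q) (h1 : q < 1) (p : ℝ) :
    klReal p q = -Real.binEntropy p - p * Real.log q - (1 - p) * Real.log (1 - q) := by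
  have key : ∀ x y : ℝ, 0 < y → x * Real.log (x / y) = x * Real.log x - x * Real.log y := by
    intro x y hy
    rcases eq_or_ne x 0 with rfl | hx
    · simp
    · rw [Real.log_div hx hy.ne']; ring
  rw [klReal, key _ _ h0, key _ _ (sub_pos.2 h1), Real.binEntropy, Real.log_inv, Real.log_inv]
  ring

theorem klReal_self {q : ℝ} (h0 : 0 < q) (h1 : q < 1) : klReal q q = 0 := by
  rw [klReal, div_self h0.ne', div_self (sub_pos.2 h1).ne']; simp

theorem convexOn_klReal {q : ℝ} (h0 : 0 < q) (h1 : q < 1) :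
    ConvexOn ℝ (Set.Icc 0 1) fun p => klReal p q := by
  simp_rw [klReal_eq h0 h1]
  have h := Real.strictConcave_binEntropy.concaveOn.neg
  have h2 : ConvexOn ℝ (Set.Icc (0 : ℝ) 1)
      fun p => -(p * Real.log q) - (1 - p) * Real.log (1 - q) := by
    refine ⟨convex_Icc 0 1, fun x _ y _ a b _ _ hab => le_of_eq ?_⟩
    simp only [smul_eq_mul]
    obtain rfl : b = 1 - a := by linarith
    ring
  refine (h.add h2).congr fun p _ => ?_
  simp only [Pi.neg_apply, Pi.add_apply]
  ring

theorem continuous_klReal {q : ℝ} (h0 : 0 < q) (h1 : q < 1) :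
    Continuous fun p => klReal p q := by
  simp_rw [klReal_eq h0 h1]
  have := Real.binEntropy_continuous
  fun_prop

/-- Dual representation of the divergence: the exponent attaining the Legendre transform. -/
theorem klReal_eq_legendre {z q : ℝ} (hz : 0 < z) (hzq : z < q) (h1 : q < 1) :
    ∃ l < 0, klReal z q = l * z - Real.log (1 - q + q * Real.exp l) := by
  have hq : 0 < q := hz.trans hzq
  have hz1 : 0 < 1 - z := by linarith
  have hq1 : 0 < 1 - q := by linarith
  -- The exponent is the log odds ratio, where the derivative of `l * z - log (1 - q + q * exp l)`
  -- in `l` vanishes; it is negative because `z < q`.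
  refine ⟨Real.log (z * (1 - q) / (q * (1 - z))), ?_, ?_⟩
  · refine Real.log_neg (by positivity) ?_
    rw [div_lt_one (by positivity)]
    nlinarith
  · rw [Real.exp_log (by positivity)]
    have : 1 - q + q * (z * (1 - q) / (q * (1 - z))) = (1 - q) / (1 - z) := by
      field_simp; ring
    rw [this, klReal, Real.log_div (mul_pos hz hq1).ne' (mul_pos hq hz1).ne',
      Real.log_div hz.ne' hq.ne', Real.log_div hz1.ne' hq1.ne',
      Real.log_div hq1.ne' hz1.ne', Real.log_mul hz.ne' hq1.ne',
      Real.log_mul hq.ne' hz1.ne']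
    ring

/-- Comparison of the Laplace transform of a `[0,1]`-valued variable with the Bernoulli one. -/
theorem integral_exp_le_bernoulli {Y : Ω → ℝ} (hY : Measurable Y) (h01 : ∀ ω, Y ω ∈ Set.Icc 0 1)
    {q : ℝ} (hq : ∫ ω, Y ω ∂P = q) (l : ℝ) :
    ∫ ω, Real.exp (l * Y ω) ∂P ≤ 1 - q + q * Real.exp l := by
  have hYi : Integrable Y P := Integrable.of_mem_Icc 0 1 hY.aemeasurable (ae_of_all _ h01)
  -- On `[0,1]` the convex function `exp (l * ·)` lies below its chord.
  have hle : ∀ ω, Real.exp (l * Y ω) ≤ 1 - Y ω + Y ω * Real.exp l := fun ω => by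
    have := convexOn_exp.2 (Set.mem_univ 0) (Set.mem_univ l)
      (sub_nonneg.2 (h01 ω).2) (h01 ω).1 (sub_add_cancel 1 (Y ω))
    simpa [mul_comm] using this
  calc ∫ ω, Real.exp (l * Y ω) ∂P ≤ ∫ ω, (1 - Y ω + Y ω * Real.exp l) ∂P := by
        refine integral_mono_of_nonneg (ae_of_all _ fun ω => (Real.exp_pos _).le) ?_
          (ae_of_all _ hle)
        exact ((integrable_const _).sub hYi).add (hYi.mul_const _)
    _ = 1 - q + q * Real.exp l := by
        have h1 : Integrable (fun ω => 1 - Y ω) P := (integrable_const _).sub hYi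
        rw [integral_add h1 (hYi.mul_const _), integral_sub (integrable_const _) hYi,
          integral_mul_const, hq]
        simp

/-- A deviation bound that is uniform over the sample sizes of a geometric slice. -/
theorem measure_klReal_slice_le {Y : ℕ → Ω → ℝ} (hY : ∀ i, Measurable (Y i))
    (h01 : ∀ i ω, Y i ω ∈ Set.Icc 0 1) (hind : iIndepFun Y P) {q : ℝ}
    (hmean : ∀ i, ∫ ω, Y i ω ∂P = q) (h0 : 0 < q) (h1 : q < 1) {δ g L : ℝ} (hδ : 0 < δ)
    (hg : 0 < g) (hL : 0 < L) (t : ℕ) :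
    P.real {ω | ∃ s : ℕ, s ≤ t ∧ L ≤ s ∧ s ≤ g * L ∧ (∑ i ∈ Finset.range s, Y i ω) / s < q ∧
      δ < s * klReal ((∑ i ∈ Finset.range s, Y i ω) / s) q} ≤ Real.exp (-(δ / g)) := by
  have hm0 : ∀ (s : ℕ) ω, 0 ≤ (∑ i ∈ Finset.range s, Y i ω) / s := fun s ω =>
    div_nonneg (Finset.sum_nonneg fun i _ => (h01 i ω).1) (Nat.cast_nonneg _)
  set B := {ω | ∃ s : ℕ, s ≤ t ∧ L ≤ s ∧ s ≤ g * L ∧ (∑ i ∈ Finset.range s, Y i ω) / s < q ∧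
      δ < s * klReal ((∑ i ∈ Finset.range s, Y i ω) / s) q} with hB
  -- A point of the event is needed to know that the level `δ / (g * L)` is attained by `klReal · q`
  -- below `q`.
  rcases B.eq_empty_or_nonempty with he | ⟨ω₀, s₀, -, hL₀, hgL₀, hlt₀, hkl₀⟩
  · rw [he]; simpa using (Real.exp_pos _).le
  have hlevel : ∀ {s : ℕ} {x : ℝ}, L ≤ s → s ≤ g * L → δ < s * x → δ / (g * L) < x := by
    intro s x hs1 hs2 hx
    have hs : (0 : ℝ) < s := hL.trans_le hs1
    calc δ / (g * L) ≤ δ / s := by gcongr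
      _ < x := by rwa [div_lt_iff₀' hs]
  have hpos : 0 < δ / (g * L) := by positivity
  -- A single threshold `z`, hence a single exponent `l`, serves all sample sizes of the slice;
  -- passing from `s` to `g * L` costs only the factor `g` in the final exponent.
  obtain ⟨z, ⟨hz1, hz2⟩, hz⟩ : δ / (g * L) ∈ (fun p => klReal p q) ''
      Set.Ioo ((∑ i ∈ Finset.range s₀, Y i ω₀) / s₀) q := by
    refine intermediate_value_Ioo' hlt₀.le (continuous_klReal h0 h1).continuousOn ⟨?_, ?_⟩
    · simpa [klReal_self h0 h1] using hpos
    · exact hlevel hL₀ hgL₀ hkl₀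
  simp only at hz
  have hz0 : 0 < z := (hm0 _ _).trans_lt hz1
  obtain ⟨l, hl, hleg⟩ := klReal_eq_legendre hz0 hz2 h1
  set φ := Real.log (1 - q + q * Real.exp l) with hφ
  have hqe : 0 < 1 - q + q * Real.exp l := by
    have := Real.exp_pos l
    nlinarith
  -- By convexity and `klReal q q = 0`, a value in `(z, q)` has divergence at most that of `z`.
  have hlez : ∀ x, 0 ≤ x → x < q → δ / (g * L) < klReal x q → x ≤ z := by
    intro x hx0 hxq hx
    by_contra! hzx
    have := (convexOn_klReal h0 h1).le_max_of_mem_Icc (x := z) (y := q) (z := x)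
      ⟨hz0.le, by linarith⟩ ⟨h0.le, h1.le⟩ ⟨hzx.le, hxq.le⟩
    rw [klReal_self h0 h1, hz, max_eq_left hpos.le] at this
    linarith
  have hYl : ∀ i ω, Real.exp (l * Y i ω) ≤ 1 := fun i ω =>
    Real.exp_le_one_iff.2 (mul_nonpos_of_nonpos_of_nonneg hl.le (h01 i ω).1)
  have hmeasE : ∀ i, Measurable fun ω => Real.exp (l * Y i ω) := fun i =>
    Real.measurable_exp.comp ((hY i).const_mul l)
  have hintE : ∀ i, Integrable (fun ω => Real.exp (l * Y i ω)) P := fun i =>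
    Integrable.of_mem_Icc 0 1 (hmeasE i).aemeasurable
      (ae_of_all _ fun ω => ⟨(Real.exp_pos _).le, hYl i ω⟩)
  -- Normalizing by the exact Laplace transforms gives factors of mean one, hence a true martingale;
  -- the Bernoulli bound `exp φ` enters only in the final comparison. The lower bound `exp l` on `c
  -- i` keeps the factors bounded.
  set c : ℕ → ℝ := fun i => ∫ ω, Real.exp (l * Y i ω) ∂P with hc
  have hlow : ∀ i, Real.exp l ≤ c i := fun i => by
    have h : ∫ _ : Ω, Real.exp l ∂P ≤ c i := by
      refine integral_mono (integrable_const _) (hintE i) fun ω => Real.exp_le_exp.2 ?_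
      nlinarith [(h01 i ω).2, (h01 i ω).1]
    simpa using h
  have hcpos : ∀ i, 0 < c i := fun i => (Real.exp_pos l).trans_le (hlow i)
  have hcφ : ∀ i, c i ≤ Real.exp φ := fun i => by
    rw [hφ, Real.exp_log hqe]
    exact integral_exp_le_bernoulli (hY i) (h01 i) (hmean i) l
  have hville := measure_exists_prod_ge_le (P := P) (Z := fun i ω => Real.exp (l * Y i ω) / c i)
    (fun i => (hmeasE i).div_const _)
    (hind.comp (fun i y => Real.exp (l * y) / c i) fun i => by fun_prop)
    (C := (Real.exp l)⁻¹)
    (fun i ω => by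
      rw [← one_div]
      exact div_le_div₀ zero_le_one (hYl i ω) (Real.exp_pos l) (hlow i))
    (fun i ω => div_nonneg (Real.exp_pos _).le (hcpos i).le)
    (fun i => by rw [integral_div]; exact div_self (hcpos i).ne')
    (Real.exp_pos (δ / g)) t
  rw [← Real.exp_neg] at hville
  refine (measureReal_mono ?_).trans hville
  rintro ω ⟨s, hst, hLs, hsg, hlt, hkl⟩
  refine ⟨s, hst, ?_⟩
  have hs : (0 : ℝ) < s := hL.trans_le hLs
  have hx := hlez _ (hm0 s ω) hlt (hlevel hLs hsg hkl)
  have hsum : ∑ i ∈ Finset.range s, Y i ω ≤ s * z := by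
    rwa [div_le_iff₀' hs] at hx
  have hexp : δ / g ≤ l * ∑ i ∈ Finset.range s, Y i ω - s * φ := by
    have h2 : l * (s * z) ≤ l * ∑ i ∈ Finset.range s, Y i ω :=
      mul_le_mul_of_nonpos_left hsum hl.le
    have h3 : δ / g = L * (δ / (g * L)) := by field_simp
    have h4 : L * (δ / (g * L)) ≤ s * (δ / (g * L)) := by gcongr
    rw [← hz, hleg] at h4
    rw [h3, ← hz, hleg]
    linarith
  calc Real.exp (δ / g) ≤ Real.exp (l * ∑ i ∈ Finset.range s, Y i ω - s * φ) :=
        Real.exp_le_exp.2 hexp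
    _ = ∏ i ∈ Finset.range s, Real.exp (l * Y i ω) / Real.exp φ := by
        rw [Finset.prod_div_distrib, ← Real.exp_sum, Finset.prod_const, Finset.card_range,
          ← Real.exp_nat_mul, ← Real.exp_sub, Finset.mul_sum]
    _ ≤ ∏ i ∈ Finset.range s, Real.exp (l * Y i ω) / c i := by
        refine Finset.prod_le_prod (fun i _ => by positivity) fun i _ => ?_
        exact div_le_div_of_nonneg_left (Real.exp_pos _).le (hcpos i) (hcφ i)

/-- Self-normalized deviation bound for the empirical means of `[0,1]`-valued variables, uniform
over the sample sizes up to `t`. -/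
theorem measure_exists_klReal_gt_le {Y : ℕ → Ω → ℝ} (hY : ∀ i, Measurable (Y i))
    (h01 : ∀ i ω, Y i ω ∈ Set.Icc 0 1) (hind : iIndepFun Y P) {q : ℝ}
    (hmean : ∀ i, ∫ ω, Y i ω ∂P = q) (h0 : 0 < q) (h1 : q < 1) {δ : ℝ} (hδ : 1 < δ)
    {t : ℕ} (ht : 1 ≤ t) :
    P.real {ω | ∃ s ∈ Finset.Icc 1 t, (∑ i ∈ Finset.range s, Y i ω) / s < q ∧
      δ < s * klReal ((∑ i ∈ Finset.range s, Y i ω) / s) q}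
      ≤ (δ * Real.log t + 1) * Real.exp (1 - δ) := by
  have hδ0 : 0 < δ := by linarith
  -- With this ratio each slice costs exactly `exp (1 - δ)`, while `log g ≥ 1 / δ` limits the number
  -- of slices to `δ * log t + 1`.
  set g := δ / (δ - 1) with hg
  have hδ1 : 0 < δ - 1 := by linarith
  have hg1 : 1 < g := by rw [hg, one_lt_div hδ1]; linarith
  have hg0 : 0 < g := by linarith
  have hδg : δ / g = δ - 1 := by rw [hg]; field_simp
  have hlogg : 1 / δ ≤ Real.log g := by
    have := Real.one_sub_inv_le_log_of_pos hg0
    have h2 : 1 - g⁻¹ = 1 / δ := by rw [hg]; field_simp; ring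
    linarith
  have hlogt : 0 ≤ Real.log t := Real.log_nonneg (by exact_mod_cast ht)
  set N := ⌊δ * Real.log t⌋₊ + 1 with hN
  have hsub : {ω | ∃ s ∈ Finset.Icc 1 t, (∑ i ∈ Finset.range s, Y i ω) / s < q ∧
      δ < s * klReal ((∑ i ∈ Finset.range s, Y i ω) / s) q} ⊆
      ⋃ k ∈ Finset.range N, {ω | ∃ s : ℕ, s ≤ t ∧ g ^ k ≤ s ∧ s ≤ g * g ^ k ∧
        (∑ i ∈ Finset.range s, Y i ω) / s < q ∧
        δ < s * klReal ((∑ i ∈ Finset.range s, Y i ω) / s) q} := by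
    rintro ω ⟨s, hs, hlt, hkl⟩
    rw [Finset.mem_Icc] at hs
    obtain ⟨k, hk1, hk2⟩ := exists_nat_pow_near (x := (s : ℝ)) (by exact_mod_cast hs.1) hg1
    rw [pow_succ'] at hk2
    refine Set.mem_biUnion (x := k) ?_ ⟨s, hs.2, hk1, hk2.le, hlt, hkl⟩
    simp only [Finset.coe_range, Set.mem_Iio]
    rw [hN, Nat.lt_succ_iff]
    refine Nat.le_floor ?_
    have h3 : (k : ℝ) * Real.log g ≤ Real.log t := by
      rw [← Real.log_pow]
      exact Real.log_le_log (by positivity) (hk1.trans (by exact_mod_cast hs.2))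
    have h4 : (k : ℝ) * (1 / δ) ≤ k * Real.log g := by gcongr
    have h5 : (k : ℝ) = δ * (k * (1 / δ)) := by field_simp
    rw [h5]
    gcongr
    linarith
  calc _ ≤ P.real (⋃ k ∈ Finset.range N, _) := measureReal_mono hsub (measure_ne_top _ _)
    _ ≤ ∑ k ∈ Finset.range N, _ := measureReal_biUnion_finset_le _ _
    _ ≤ ∑ k ∈ Finset.range N, Real.exp (-(δ / g)) := Finset.sum_le_sum fun k _ =>
        measure_klReal_slice_le hY h01 hind hmean h0 h1 hδ0 hg0 (pow_pos hg0 k) t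
    _ = N * Real.exp (1 - δ) := by
        rw [Finset.sum_const, Finset.card_range, nsmul_eq_mul, hδg, neg_sub]
    _ ≤ (δ * Real.log t + 1) * Real.exp (1 - δ) := by
        gcongr
        rw [hN]
        push_cast
        linarith [Nat.floor_le (mul_nonneg hδ0.le hlogt)]

/-- The expected number of sample sizes at which the empirical mean exceeds a level above the
expectation is finite. -/
theorem summable_measure_mean_gt {Y : ℕ → Ω → ℝ} (hY : ∀ i, Measurable (Y i))
    (h01 : ∀ i ω, Y i ω ∈ Set.Icc 0 1) (hind : iIndepFun Y P) {m : ℝ}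
    (hmean : ∀ i, ∫ ω, Y i ω ∂P = m) {r : ℝ} (hr : m < r) :
    Summable fun s : ℕ => P.real {ω | r < (∑ i ∈ Finset.range s, Y i ω) / s} := by
  have hsub : ∀ i, HasSubgaussianMGF (fun ω => Y i ω - m) ((‖(1 : ℝ) - 0‖₊ / 2) ^ 2) P := fun i => by
    have := hasSubgaussianMGF_of_mem_Icc (hY i).aemeasurable (ae_of_all P (h01 i))
    rwa [hmean] at this
  have hind' : iIndepFun (fun i ω => Y i ω - m) P :=
    hind.comp (fun _ y => y - m) fun _ => by fun_prop
  have hgeo : Summable fun s : ℕ => Real.exp (s * -(2 * (r - m) ^ 2)) :=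
    Real.summable_exp_nat_mul_iff.2 (by nlinarith [sq_pos_of_pos (sub_pos.2 hr)])
  -- The term `s = 0` is discarded, since there the mean is the default value `0 / 0 = 0`.
  refine (summable_nat_add_iff 1).1 (Summable.of_nonneg_of_le (fun _ => measureReal_nonneg)
    (fun s => ?_) ((summable_nat_add_iff 1).2 hgeo))
  have hs : (0 : ℝ) < ((s + 1 : ℕ) : ℝ) := by positivity
  have h := HasSubgaussianMGF.measure_sum_range_ge_le_of_iIndepFun hind' (n := s + 1)
    (fun i _ => hsub i) (ε := (s + 1 : ℕ) * (r - m)) (mul_nonneg hs.le (sub_pos.2 hr).le)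
  refine (measureReal_mono fun ω hω => ?_).trans (h.trans_eq ?_)
  · change (s + 1 : ℕ) * (r - m) ≤ ∑ i ∈ Finset.range (s + 1), (Y i ω - m)
    rw [Set.mem_ofPred_eq, lt_div_iff₀ hs] at hω
    rw [Finset.sum_sub_distrib, Finset.sum_const, Finset.card_range, nsmul_eq_mul]
    linarith
  · congr 1
    simp only [sub_zero, nnnorm_one, NNReal.coe_pow, NNReal.coe_div, NNReal.coe_one,
      NNReal.coe_ofNat]
    field_simp

end Deviations

/-! ### Pull counts, independence from the past, and the regret decomposition. -/

section Wald

variable {Ω : Type*} {K : ℕ}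

theorem numPulls_zero (A : ℕ → Ω → Fin K) (a : Fin K) (ω : Ω) : numPulls A a 0 ω = 0 := by
  simp [numPulls]

theorem numPulls_succ (A : ℕ → Ω → Fin K) (a : Fin K) (t : ℕ) (ω : Ω) :
    numPulls A a (t + 1) ω = numPulls A a t ω + if A (t + 1) ω = a then 1 else 0 := by
  rw [numPulls, numPulls, ← Finset.insert_Icc_right_eq_Icc_add_one (by omega),
    Finset.filter_insert]
  split_ifs with h
  · rw [Finset.card_insert_of_notMem (by simp)]
  · simp

theorem numPulls_mono (A : ℕ → Ω → Fin K) (a : Fin K) (ω : Ω) :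
    Monotone fun t => numPulls A a t ω :=
  monotone_nat_of_le_succ fun t => by rw [numPulls_succ]; exact Nat.le_add_right _ _

theorem numPulls_le (A : ℕ → Ω → Fin K) (a : Fin K) (t : ℕ) (ω : Ω) : numPulls A a t ω ≤ t :=
  (Finset.card_filter_le _ _).trans (by simp)

theorem sum_numPulls (A : ℕ → Ω → Fin K) (t : ℕ) (ω : Ω) : ∑ a, numPulls A a t ω = t := by
  induction t with
  | zero => simp [numPulls_zero]
  | succ t ih => simp [numPulls_succ, Finset.sum_add_distrib, ih]

/-- Each arm's reward sequence is consumed in order, so an adaptively collected sum is a prefix sum.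
Deviation bounds uniform in the prefix length therefore apply despite the adaptive sampling. -/
theorem sum_filter_reward (X : Fin K → ℕ → Ω → I) (A : ℕ → Ω → Fin K) (a : Fin K) (t : ℕ) (ω : Ω) :
    ∑ s ∈ (Finset.Icc 1 t).filter (fun s => A s ω = a), (reward X A s ω : ℝ)
      = ∑ i ∈ Finset.range (numPulls A a t ω), (X a i ω : ℝ) := by
  induction t with
  | zero => simp [numPulls_zero]
  | succ t ih =>
    rw [numPulls_succ, ← Finset.insert_Icc_right_eq_Icc_add_one (by omega), Finset.filter_insert]
    split_ifs with h
    · rw [Finset.sum_insert (by simp), ih, Finset.sum_range_succ, add_comm]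
      simp [reward, h]
    · rw [ih, add_zero]

theorem sum_reward (X : Fin K → ℕ → Ω → I) (A : ℕ → Ω → Fin K) (t : ℕ) (ω : Ω) :
    ∑ s ∈ Finset.Icc 1 t, (reward X A s ω : ℝ)
      = ∑ a, ∑ i ∈ Finset.range (numPulls A a t ω), (X a i ω : ℝ) := by
  simp_rw [← sum_filter_reward]
  exact (Finset.sum_fiberwise _ _ _).symm

/-- The σ-algebra of the sets whose trace on `S` is measurable. -/
@[reducible] def traceMeasurableSpace (m : MeasurableSpace Ω) {S : Set Ω} (hS : MeasurableSet[m] S) :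
    MeasurableSpace Ω where
  MeasurableSet' B := MeasurableSet[m] (B ∩ S)
  measurableSet_empty := by simp
  measurableSet_compl B hB := by
    have : Bᶜ ∩ S = S \ (B ∩ S) := by ext; simp; tauto
    rw [this]; exact hS.diff hB
  measurableSet_iUnion f hf := by rw [Set.iUnion_inter]; exact MeasurableSet.iUnion hf

/-- The information carried by the randomization, by the arms other than `a`, and by the first `n`
rewards of arm `a`. -/
@[reducible] def otherRewards {E : Type*} [MeasurableSpace E] (U : Ω → E) (X : Fin K → ℕ → Ω → I)
    (a : Fin K) (n : ℕ) : MeasurableSpace Ω :=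
  MeasurableSpace.comap U inferInstance ⊔
    ⨆ k ∈ {k : Fin K × ℕ | ¬ (k.1 = a ∧ n ≤ k.2)}, MeasurableSpace.comap (X k.1 k.2) inferInstance

theorem past_one {E : Type*} [MeasurableSpace E] (U : Ω → E) (X : Fin K → ℕ → Ω → I)
    (A : ℕ → Ω → Fin K) : past U X A 1 = MeasurableSpace.comap U inferInstance := by
  simp [past]

theorem past_succ {E : Type*} [MeasurableSpace E] (U : Ω → E) (X : Fin K → ℕ → Ω → I)
    (A : ℕ → Ω → Fin K) {t : ℕ} (ht : 1 ≤ t) :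
    past U X A (t + 1) = past U X A t ⊔ (MeasurableSpace.comap (A t) inferInstance ⊔
      MeasurableSpace.comap (reward X A t) inferInstance) := by
  have : Set.Ico 1 (t + 1) = insert t (Set.Ico 1 t) := by ext; simp; omega
  rw [past, this, iSup_insert, past]
  ac_rfl

theorem past_mono {E : Type*} [MeasurableSpace E] (U : Ω → E) (X : Fin K → ℕ → Ω → I)
    (A : ℕ → Ω → Fin K) : Monotone (past U X A) := fun _ _ h =>
  sup_le_sup_left (biSup_mono fun _ hs => ⟨hs.1, hs.2.trans_le h⟩) _

theorem measurable_numPulls_past {E : Type*} [MeasurableSpace E] {U : Ω → E}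
    {X : Fin K → ℕ → Ω → I} {A : ℕ → Ω → Fin K}
    (hA : ∀ t, 1 ≤ t → Measurable[past U X A t] (A t)) (a : Fin K) (t : ℕ) :
    Measurable[past U X A t] (numPulls A a t) := by
  induction t with
  | zero =>
    have : numPulls A a 0 = fun _ => 0 := funext fun ω => numPulls_zero A a ω
    rw [this]; exact measurable_const
  | succ t ih =>
    have : numPulls A a (t + 1) = fun ω => numPulls A a t ω + if A (t + 1) ω = a then 1 else 0 :=
      funext fun ω => numPulls_succ A a t ω
    rw [this]
    have h1 : Measurable[past U X A (t + 1)] (numPulls A a t) :=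
      ih.mono (past_mono U X A t.le_succ) le_rfl
    have h2 := hA (t + 1) (by omega)
    refine h1.add (Measurable.ite (h2 (measurableSet_singleton a)) measurable_const
      measurable_const)

/-- Before the `(n+1)`-st pull of arm `a` is decided, only `otherRewards` has been used. -/
theorem past_le_traceMeasurableSpace {E : Type*} [MeasurableSpace E] {U : Ω → E}
    {X : Fin K → ℕ → Ω → I} {A : ℕ → Ω → Fin K}
    (hA : ∀ t, 1 ≤ t → Measurable[past U X A t] (A t)) (a : Fin K) (n : ℕ) (t : ℕ) :
    ∃ h : MeasurableSet[otherRewards U X a n] {ω | numPulls A a t ω ≤ n},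
      past U X A (t + 1) ≤ traceMeasurableSpace (otherRewards U X a n) h := by
  induction t with
  | zero =>
    have h : {ω | numPulls A a 0 ω ≤ n} = Set.univ := by simp [numPulls_zero]
    refine ⟨by rw [h]; exact MeasurableSet.univ, ?_⟩
    rw [zero_add, past_one]
    intro B hB
    change MeasurableSet[otherRewards U X a n] (B ∩ _)
    rw [h, Set.inter_univ]
    exact (le_sup_left : _ ≤ otherRewards U X a n) B hB
  | succ t ih =>
    obtain ⟨hS, hle⟩ := ih
    have hinter : {ω | numPulls A a (t + 1) ω ≤ n}
        = {ω | numPulls A a (t + 1) ω ≤ n} ∩ {ω | numPulls A a t ω ≤ n} := by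
      refine (Set.inter_eq_left.2 fun ω hω => ?_).symm
      exact (numPulls_mono A a ω t.le_succ).trans hω
    have hN := fun b => measurable_numPulls_past hA b (t + 1)
    have hS' : MeasurableSet[otherRewards U X a n] {ω | numPulls A a (t + 1) ω ≤ n} := by
      rw [hinter]
      exact hle _ (hN a (measurableSet_Iic (a := n)))
    have hle' : past U X A (t + 1) ≤ traceMeasurableSpace (otherRewards U X a n) hS' := by
      intro B hB
      change MeasurableSet[otherRewards U X a n] (B ∩ _)
      rw [hinter, Set.inter_comm {ω | numPulls A a (t + 1) ω ≤ n}, ← Set.inter_assoc]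
      exact MeasurableSet.inter (hle B hB) hS'
    refine ⟨hS', ?_⟩
    rw [past_succ _ _ _ (by omega)]
    refine sup_le hle' (sup_le ((hA (t + 1) (by omega)).comap_le.trans hle') ?_)
    rintro _ ⟨C, hC, rfl⟩
    change MeasurableSet[otherRewards U X a n] (_ ∩ _)
    -- Splitting by the chosen arm and its earlier pull count replaces the adaptive reward by fixed
    -- variables `X b j`.
    have hdecomp : reward X A (t + 1) ⁻¹' C ∩ {ω | numPulls A a (t + 1) ω ≤ n}
        = ⋃ b : Fin K, ⋃ j : ℕ, (({ω | A (t + 1) ω = b} ∩ {ω | numPulls A b t ω = j})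
          ∩ {ω | numPulls A a (t + 1) ω ≤ n}) ∩ X b j ⁻¹' C := by
      ext ω
      simp only [Set.mem_inter_iff, Set.mem_preimage, Set.mem_iUnion, Set.mem_ofPred_eq, reward,
        Nat.add_sub_cancel]
      constructor
      · rintro ⟨h1, h2⟩
        exact ⟨_, _, ⟨⟨rfl, rfl⟩, h2⟩, h1⟩
      · rintro ⟨b, j, ⟨⟨rfl, rfl⟩, h2⟩, h1⟩
        exact ⟨h1, h2⟩
    rw [hdecomp]
    refine MeasurableSet.iUnion fun b => MeasurableSet.iUnion fun j => ?_
    by_cases hbj : b = a ∧ n ≤ j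
    -- Reading entry `j ≥ n` of arm `a` would raise its count to `j + 1 > n`, so this piece is
    -- empty.
    · obtain ⟨rfl, hj⟩ := hbj
      convert! MeasurableSet.empty using 1
      ext ω
      simp only [Set.mem_inter_iff, Set.mem_ofPred_eq, Set.mem_preimage, Set.mem_empty_iff_false,
        iff_false]
      rintro ⟨⟨⟨h1, h2⟩, h3⟩, -⟩
      rw [numPulls_succ, if_pos h1] at h3
      omega
    · refine MeasurableSet.inter (hle' _ (MeasurableSet.inter ?_ ?_)) ?_
      · exact hA (t + 1) (by omega) (measurableSet_singleton b)
      · exact (measurable_numPulls_past hA b t).mono (past_mono U X A t.le_succ) le_rfl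
          (measurableSet_singleton j)
      · refine le_sup_right (a := MeasurableSpace.comap U inferInstance) _ ?_
        exact le_iSup₂_of_le (f := fun k (_ : k ∈ {k : Fin K × ℕ | ¬ (k.1 = a ∧ n ≤ k.2)}) =>
          MeasurableSpace.comap (X k.1 k.2) inferInstance) (b, j) hbj le_rfl _ ⟨C, hC, rfl⟩

/-- Intersections of a set of `m₃` with a set of `m₂` form a π-system generating `m₃ ⊔ m₂`, and on
it the product formula follows by splitting off the `m₃` factor first. Here `m₃` is the
randomization, independent of all rewards jointly. -/
theorem indep_sup_of_indep_sup {m₀ : MeasurableSpace Ω} {P : Measure Ω} [IsProbabilityMeasure P]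
    {m₁ m₂ m₃ : MeasurableSpace Ω} (h₁ : m₁ ≤ m₀) (h₂ : m₂ ≤ m₀) (h₃ : m₃ ≤ m₀)
    (h12 : Indep m₁ m₂ P) (h3 : Indep m₃ (m₁ ⊔ m₂) P) :
    Indep m₁ (m₃ ⊔ m₂) P := by
  have hgen : m₃ ⊔ m₂ = MeasurableSpace.generateFrom
      (Set.image2 (· ∩ ·) {s | MeasurableSet[m₃] s} {s | MeasurableSet[m₂] s}) := by
    refine le_antisymm (sup_le (fun s hs => ?_) fun s hs => ?_) (MeasurableSpace.generateFrom_le ?_)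
    · exact MeasurableSpace.measurableSet_generateFrom
        ⟨s, hs, Set.univ, MeasurableSet.univ, Set.inter_univ s⟩
    · exact MeasurableSpace.measurableSet_generateFrom
        ⟨Set.univ, MeasurableSet.univ, s, hs, Set.univ_inter s⟩
    · rintro _ ⟨s, hs, t, ht, rfl⟩
      exact MeasurableSet.inter ((le_sup_left : m₃ ≤ m₃ ⊔ m₂) s hs)
        ((le_sup_right : m₂ ≤ m₃ ⊔ m₂) t ht)
  refine IndepSets.indep h₁ (sup_le h₃ h₂) (@MeasurableSpace.isPiSystem_measurableSet Ω m₁) ?_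
    (@MeasurableSpace.generateFrom_measurableSet Ω m₁).symm hgen ?_
  · rintro _ ⟨s, hs, t, ht, rfl⟩ _ ⟨s', hs', t', ht', rfl⟩ -
    exact ⟨s ∩ s', MeasurableSet.inter hs hs', t ∩ t', MeasurableSet.inter ht ht',
      (Set.inter_inter_inter_comm _ _ _ _).symm⟩
  · rw [IndepSets_iff]
    rintro r _ hr ⟨s, hs, t, ht, rfl⟩
    rw [Indep_iff] at h12 h3
    have hr' : MeasurableSet[m₁ ⊔ m₂] r := (le_sup_left : m₁ ≤ m₁ ⊔ m₂) r hr
    have ht' : MeasurableSet[m₁ ⊔ m₂] t := (le_sup_right : m₂ ≤ m₁ ⊔ m₂) t ht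
    have e : r ∩ (s ∩ t) = s ∩ (r ∩ t) := Set.inter_left_comm _ _ _
    change P (r ∩ (s ∩ t)) = P r * P (s ∩ t)
    rw [e, h3 s _ hs (hr'.inter ht'), h3 s t hs ht', h12 r t hr ht]
    ring

theorem measurableSet_numPulls_le {E : Type*} [MeasurableSpace E] {U : Ω → E}
    {X : Fin K → ℕ → Ω → I} {A : ℕ → Ω → Fin K}
    (hA : ∀ t, 1 ≤ t → Measurable[past U X A t] (A t)) (a : Fin K) (n t : ℕ) :
    MeasurableSet[otherRewards U X a n] {ω | numPulls A a t ω ≤ n} :=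
  (past_le_traceMeasurableSpace hA a n t).1

variable {E : Type*} [MeasurableSpace Ω] [MeasurableSpace E] {P : Measure Ω}
  {ν : Fin K → Measure I} {U : Ω → E} {X : Fin K → ℕ → Ω → I}
  {A : ℕ → Ω → Fin K}

theorem otherRewards_le (hX : IsBanditEnvironment P ν U X) (a : Fin K) (n : ℕ) :
    otherRewards U X a n ≤ ‹MeasurableSpace Ω› :=
  sup_le hX.measurable_rand.comap_le
    (iSup₂_le fun k _ => (hX.measurable_reward k.1 k.2).comap_le)

theorem integral_reward_eq [∀ a, IsProbabilityMeasure (ν a)] (hX : IsBanditEnvironment P ν U X)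
    (a : Fin K) (i : ℕ) : ∫ ω, (X a i ω : ℝ) ∂P = armMean (ν a) := by
  have := integral_map (μ := P) (hX.measurable_reward a i).aemeasurable
    (f := fun x : I => (x : ℝ)) measurable_subtype_coe.aestronglyMeasurable
  rw [hX.law] at this
  exact this.symm

theorem measurable_numPulls (hX : IsBanditEnvironment P ν U X)
    (hA : ∀ t, 1 ≤ t → Measurable[past U X A t] (A t)) (a : Fin K) (t : ℕ) :
    Measurable (numPulls A a t) :=
  measurable_of_Iic fun n => otherRewards_le hX a n _ (measurableSet_numPulls_le hA a n t)

variable [IsProbabilityMeasure P]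

theorem indep_otherRewards (hX : IsBanditEnvironment P ν U X) (a : Fin K) (n : ℕ) :
    Indep (MeasurableSpace.comap (X a n) inferInstance) (otherRewards U X a n) P := by
  have hle : ∀ k : Fin K × ℕ, MeasurableSpace.comap (X k.1 k.2) inferInstance
      ≤ MeasurableSpace.comap (fun ω (k : Fin K × ℕ) => X k.1 k.2 ω) inferInstance := fun k => by
    rintro _ ⟨C, hC, rfl⟩
    exact ⟨(fun x => x k) ⁻¹' C, measurable_pi_apply k hC, rfl⟩
  refine indep_sup_of_indep_sup (hX.measurable_reward a n).comap_le
    (iSup₂_le fun k _ => (hX.measurable_reward k.1 k.2).comap_le) hX.measurable_rand.comap_le ?_ ?_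
  · have := indep_iSup_of_disjoint (fun k : Fin K × ℕ => (hX.measurable_reward k.1 k.2).comap_le)
      hX.indep.iIndep (S := {(a, n)}) (T := {k : Fin K × ℕ | ¬ (k.1 = a ∧ n ≤ k.2)}) (by simp)
    simpa using this
  · exact indep_of_indep_of_le_right hX.indep_rand (sup_le (hle (a, n)) (iSup₂_le fun k _ => hle k))

theorem integrable_numPulls (hX : IsBanditEnvironment P ν U X)
    (hA : ∀ t, 1 ≤ t → Measurable[past U X A t] (A t)) (a : Fin K) (t : ℕ) :
    Integrable (fun ω => (numPulls A a t ω : ℝ)) P :=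
  Integrable.of_mem_Icc 0 t (measurable_from_nat.comp (measurable_numPulls hX hA a t)).aemeasurable
    (ae_of_all _ fun ω => ⟨Nat.cast_nonneg _, Nat.cast_le.2 (numPulls_le A a t ω)⟩)

theorem sum_range_eq_sum_indicator {n t : ℕ} (h : n ≤ t) (f : ℕ → ℝ) :
    ∑ i ∈ Finset.range n, f i = ∑ i ∈ Finset.range t, (if i < n then 1 else 0) * f i := by
  simp_rw [ite_mul, one_mul, zero_mul]
  rw [← Finset.sum_filter]
  congr 1
  ext i; simp; omega

theorem integrable_pull_mul_reward (hX : IsBanditEnvironment P ν U X)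
    (hA : ∀ t, 1 ≤ t → Measurable[past U X A t] (A t)) (a : Fin K) (t i : ℕ) :
    Integrable (fun ω => (if i < numPulls A a t ω then (1 : ℝ) else 0) * (X a i ω : ℝ)) P := by
  refine Integrable.of_mem_Icc 0 1 (Measurable.aemeasurable ?_) (ae_of_all _ fun ω => ?_)
  · exact (Measurable.ite (measurable_numPulls hX hA a t measurableSet_Ioi) measurable_const
      measurable_const).mul (measurable_subtype_coe.comp (hX.measurable_reward a i))
  · split_ifs
    · rw [one_mul]; exact (X a i ω).2
    · simp

/-- Wald's identity for the rewards of an arm. -/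
theorem integral_sum_pulls [∀ a, IsProbabilityMeasure (ν a)] (hX : IsBanditEnvironment P ν U X)
    (hA : ∀ t, 1 ≤ t → Measurable[past U X A t] (A t)) (a : Fin K) (t : ℕ) :
    ∫ ω, ∑ i ∈ Finset.range (numPulls A a t ω), (X a i ω : ℝ) ∂P
      = (armMean (ν a) : ℝ) * ∫ ω, (numPulls A a t ω : ℝ) ∂P := by
  have hstep : ∀ i, ∫ ω, (if i < numPulls A a t ω then (1 : ℝ) else 0) * (X a i ω : ℝ) ∂P
      = (∫ ω, (if i < numPulls A a t ω then (1 : ℝ) else 0) ∂P) * (armMean (ν a) : ℝ) := by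
    intro i
    rw [← integral_reward_eq hX a i]
    -- The event `i < numPulls A a t` is the complement of `numPulls A a t ≤ i`, which is decided
    -- without seeing `X a i`.
    have hm : Measurable[otherRewards U X a i]
        fun ω => if i < numPulls A a t ω then (1 : ℝ) else 0 := by
      refine Measurable.ite ?_ measurable_const measurable_const
      have := (measurableSet_numPulls_le hA a i t).compl
      convert! this using 1
      ext ω; simp
    have hmX : Measurable[MeasurableSpace.comap (X a i) inferInstance]
        fun ω => (X a i ω : ℝ) := measurable_subtype_coe.comp (comap_measurable (X a i))
    have hind : IndepFun (fun ω => if i < numPulls A a t ω then (1 : ℝ) else 0)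
        (fun ω => (X a i ω : ℝ)) P :=
      indep_of_indep_of_le (indep_otherRewards hX a i).symm hm.comap_le hmX.comap_le
    exact hind.integral_fun_mul_eq_mul_integral
      (hm.mono (otherRewards_le hX a i) le_rfl).aestronglyMeasurable
      (hmX.mono (hX.measurable_reward a i).comap_le le_rfl).aestronglyMeasurable
  have hN : ∀ ω, (numPulls A a t ω : ℝ)
      = ∑ i ∈ Finset.range t, (if i < numPulls A a t ω then (1 : ℝ) else 0) := fun ω => by
    simp [← Finset.mem_range, Finset.inter_eq_right.2
      (Finset.range_subset_range.2 (numPulls_le A a t ω))]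
  have hi : ∀ i, Integrable (fun ω => if i < numPulls A a t ω then (1 : ℝ) else 0) P := fun i =>
    Integrable.of_mem_Icc 0 1 (Measurable.ite (measurable_numPulls hX hA a t measurableSet_Ioi)
      measurable_const measurable_const).aemeasurable (ae_of_all _ fun ω => by split_ifs <;> simp)
  simp_rw [fun ω => sum_range_eq_sum_indicator (numPulls_le A a t ω) fun i => (X a i ω : ℝ), hN]
  rw [integral_finsetSum _ fun i _ => integrable_pull_mul_reward hX hA a t i,
    integral_finsetSum _ fun i _ => hi i, Finset.mul_sum]
  exact Finset.sum_congr rfl fun i _ => by rw [hstep, mul_comm]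

/-- The regret is the sum of the expected numbers of pulls, weighted by the gaps. -/
theorem regret_eq [∀ a, IsProbabilityMeasure (ν a)] (hX : IsBanditEnvironment P ν U X)
    (hA : ∀ t, 1 ≤ t → Measurable[past U X A t] (A t)) (T : ℕ) :
    regret P ν X A T = ∑ a, ((bestMean ν : ℝ) - (armMean (ν a) : ℝ))
      * ∫ ω, (numPulls A a T ω : ℝ) ∂P := by
  have hint : ∀ a, Integrable
      (fun ω => ∑ i ∈ Finset.range (numPulls A a T ω), (X a i ω : ℝ)) P := fun a => by
    simp_rw [fun ω => sum_range_eq_sum_indicator (numPulls_le A a T ω) fun i => (X a i ω : ℝ)]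
    exact integrable_finsetSum _ fun i _ => integrable_pull_mul_reward hX hA a T i
  have hT : ∑ a, ∫ ω, (numPulls A a T ω : ℝ) ∂P = T := by
    rw [← integral_finsetSum _ fun a _ => integrable_numPulls hX hA a T]
    simp_rw [← Nat.cast_sum, sum_numPulls]
    simp
  rw [regret]
  simp_rw [sum_reward]
  rw [integral_sub (integrable_const _) (integrable_finsetSum _ fun a _ => hint a),
    integral_finsetSum _ fun a _ => hint a]
  simp_rw [integral_sum_pulls hX hA, sub_mul]
  rw [Finset.sum_sub_distrib, ← Finset.mul_sum, hT]
  simp [mul_comm]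

end Wald

/-! ### Exploration rate and pathwise analysis of the indices. -/

section UCB

/-- The exploration rate `log t + 3 log log t`. -/
noncomputable def explorationRate (t : ℕ) : ℝ := Real.log t + 3 * Real.log (Real.log t)

theorem one_lt_log_of_three_le {t : ℕ} (ht : 3 ≤ t) : 1 < Real.log t := by
  have h3 : (3 : ℝ) ≤ t := by exact_mod_cast ht
  rw [Real.lt_log_iff_exp_lt (by linarith)]
  linarith [Real.exp_one_lt_d9]

theorem one_lt_explorationRate {t : ℕ} (ht : 3 ≤ t) : 1 < explorationRate t := by
  have h := one_lt_log_of_three_le ht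
  have := Real.log_pos h
  rw [explorationRate]; linarith

theorem explorationRate_mono {t T : ℕ} (ht : 3 ≤ t) (h : t ≤ T) :
    explorationRate t ≤ explorationRate T := by
  have h1 := one_lt_log_of_three_le ht
  have h2 : Real.log t ≤ Real.log T :=
    Real.log_le_log (by exact_mod_cast (by omega : 0 < t)) (by exact_mod_cast h)
  have h3 : Real.log (Real.log t) ≤ Real.log (Real.log T) := Real.log_le_log (by linarith) h2
  rw [explorationRate, explorationRate]; linarith

/-- With `L = log t`, the exponential equals `e / (t * L ^ 3)`, and the prefactor is at most `5 * L
^ 2` because `log L ≤ L` and `1 ≤ L`. The coefficient 3 of `log log t` thus leaves a spare factor `1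
/ L`. -/
theorem peeling_bound_le {t : ℕ} (ht : 3 ≤ t) :
    (explorationRate t * Real.log t + 1) * Real.exp (1 - explorationRate t)
      ≤ 5 * Real.exp 1 * (Real.log t)⁻¹ * (t : ℝ)⁻¹ := by
  have h1 := one_lt_log_of_three_le ht
  have ht0 : (0 : ℝ) < t := by exact_mod_cast (by omega : 0 < t)
  rw [explorationRate]
  set L := Real.log t with hL
  have hL0 : 0 < L := by linarith
  have hexp : Real.exp (1 - (L + 3 * Real.log L)) = Real.exp 1 * (t : ℝ)⁻¹ * (L ^ 3)⁻¹ := by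
    rw [← sub_sub, sub_eq_add_neg, sub_eq_add_neg, Real.exp_add, Real.exp_add, Real.exp_neg,
      Real.exp_neg, hL, Real.exp_log ht0, ← hL]
    congr 2
    rw [show 3 * Real.log L = (3 : ℕ) * Real.log L by norm_num, Real.exp_nat_mul, Real.exp_log hL0]
  have hloglog : Real.log L ≤ L := (Real.log_le_sub_one_of_pos hL0).trans (by linarith)
  have h2 : (L + 3 * Real.log L) * L + 1 ≤ 5 * L ^ 2 := by nlinarith
  rw [hexp]
  calc ((L + 3 * Real.log L) * L + 1) * (Real.exp 1 * (t : ℝ)⁻¹ * (L ^ 3)⁻¹)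
      ≤ 5 * L ^ 2 * (Real.exp 1 * (t : ℝ)⁻¹ * (L ^ 3)⁻¹) := by gcongr
    _ = _ := by field_simp

variable {Ω E : Type*} {K : ℕ}

/-- At time `t`, for some sample size, the empirical mean of arm `b` is significantly below `q`. -/
def underestimation (X : Fin K → ℕ → Ω → I) (b : Fin K) (q : ℝ) (t : ℕ) : Set Ω :=
  {ω | ∃ s ∈ Finset.Icc 1 t, (∑ i ∈ Finset.range s, (X b i ω : ℝ)) / s < q ∧
    (q = 1 ∨ explorationRate t < s * klReal ((∑ i ∈ Finset.range s, (X b i ω : ℝ)) / s) q)}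

theorem coe_empMean (X : Fin K → ℕ → Ω → I) (A : ℕ → Ω → Fin K) (a : Fin K) (t : ℕ) (ω : Ω) :
    (empMean X A a t ω : ℝ)
      = (∑ i ∈ Finset.range (numPulls A a t ω), (X a i ω : ℝ)) / numPulls A a t ω := by
  rw [← sum_filter_reward]; rfl

theorem natCast_mul_le_iff {N : ℕ} (hN : 1 ≤ N) (x : EReal) (f : ℝ) :
    (N : EReal) * x ≤ (f : EReal) ↔ x ≤ ((f / N : ℝ) : EReal) := by
  have hN0 : (0 : EReal) < N := by exact_mod_cast hN
  rw [EReal.coe_div, EReal.coe_coe_eq_natCast,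
    EReal.le_div_iff_mul_le hN0 (EReal.natCast_ne_top N), mul_comm]

theorem exists_isGreatest_ucbIndex {d : I → I → EReal} (hmax : HasUpperConfidenceBounds d)
    {X : Fin K → ℕ → Ω → I} {A : ℕ → Ω → Fin K} {a : Fin K} {t : ℕ} {ω : Ω}
    (hN : 1 ≤ numPulls A a (t - 1) ω) (ht : 3 ≤ t) :
    ∃ u : I, ucbIndex d 3 X A a t ω = u ∧ IsGreatest {q : I | d (empMean X A a (t - 1) ω) q
      ≤ ((explorationRate t / numPulls A a (t - 1) ω : ℝ) : EReal)} u := by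
  have hf : 0 < explorationRate t := by linarith [one_lt_explorationRate ht]
  obtain ⟨u, hu⟩ := hmax (empMean X A a (t - 1) ω)
    (explorationRate t / numPulls A a (t - 1) ω) (div_pos hf (by exact_mod_cast hN))
  refine ⟨u, ?_, hu⟩
  rw [ucbIndex]
  simp_rw [natCast_mul_le_iff hN]
  have hmono : Monotone fun q : I => (q : ℝ) := fun _ _ h => h
  exact (hmono.map_isGreatest hu).csSup_eq

/-- The empirical mean is feasible for its own index, so it lies below `q`; infeasibility of `q`
makes `d`, and by domination the Bernoulli divergence, exceed `explorationRate t / N`. The random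
count `N` is absorbed by the quantifier over `s`. -/
theorem mem_underestimation_of_ucbIndex_lt {d : I → I → EReal} (hd : IsStrongSemiDistance d)
    (hkl : IsKLDominated d) (hmax : HasUpperConfidenceBounds d)
    {X : Fin K → ℕ → Ω → I} {A : ℕ → Ω → Fin K} {b : Fin K} {t : ℕ} {ω : Ω} {q : I}
    (hN : 1 ≤ numPulls A b (t - 1) ω) (ht : 3 ≤ t) (h : ucbIndex d 3 X A b t ω < q) :
    ω ∈ underestimation X b q t := by
  obtain ⟨u, hu, hgr⟩ := exists_isGreatest_ucbIndex (X := X) hmax hN ht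
  rw [hu] at h
  set N := numPulls A b (t - 1) ω with hNdef
  set x := empMean X A b (t - 1) ω with hx
  have hf : 0 < explorationRate t := by linarith [one_lt_explorationRate ht]
  have hN0 : (0 : ℝ) < N := by exact_mod_cast hN
  have hxu : x ≤ u := hgr.2 (by
    rw [Set.mem_ofPred_eq, (hd.eq_zero_iff x x).2 rfl]
    exact_mod_cast (div_pos hf hN0).le)
  have hxq : x < q := hxu.trans_lt h
  have hnot : ((explorationRate t / N : ℝ) : EReal) < d x q := by
    by_contra! hle
    exact absurd (hgr.2 hle) (not_le.2 h)
  have hNt : N ≤ t := (numPulls_le A b (t - 1) ω).trans (Nat.sub_le _ _)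
  have hxe := coe_empMean X A b (t - 1) ω
  refine ⟨N, Finset.mem_Icc.2 ⟨hN, hNt⟩, by rw [← hxe]; exact hxq, ?_⟩
  rw [← hxe, ← hx]
  -- At `q = 1` the divergence is `⊤`, whereas `klReal` takes a default value through division by
  -- zero; hence the separate disjunct.
  by_cases hq1 : q = 1
  · left; rw [hq1]; rfl
  right
  have hq0 : q ≠ 0 := fun h0 => by rw [h0] at hxq; exact absurd hxq (not_lt.2 x.2.1)
  have hlt := hnot.trans_le (hkl x q)
  rw [bernoulliKL, if_neg (by tauto)] at hlt
  have := EReal.coe_lt_coe_iff.1 hlt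
  rwa [div_lt_iff₀' hN0] at this

/-- If the mean `x` is at most `r`, the two monotonicities give `M < d r q ≤ d x q ≤ d x u ≤
explorationRate t / N`, where `u` is the index and `N` the count. -/
theorem mean_ge_or_of_le_ucbIndex {d : I → I → EReal} (hd : IsStrongSemiDistance d)
    (hmax : HasUpperConfidenceBounds d)
    {X : Fin K → ℕ → Ω → I} {A : ℕ → Ω → Fin K} {a : Fin K} {t : ℕ} {ω : Ω} {q r : I} {M : ℝ}
    (hM : 0 < M) (hrq : r ≤ q) (hr : (M : EReal) < d r q)
    (hN : 1 ≤ numPulls A a (t - 1) ω) (ht : 3 ≤ t) (h : (q : ℝ) ≤ ucbIndex d 3 X A a t ω) :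
    r < empMean X A a (t - 1) ω ∨ (numPulls A a (t - 1) ω : ℝ) ≤ explorationRate t / M := by
  obtain ⟨u, hu, hgr⟩ := exists_isGreatest_ucbIndex (X := X) hmax hN ht
  rw [hu] at h
  by_contra! hcon
  obtain ⟨hxr, hNM⟩ := hcon
  have h1 := hd.anti_left _ _ _ hxr hrq
  have h2 := hd.mono_right _ _ _ (hxr.trans hrq) h
  have h3 := EReal.coe_lt_coe_iff.1 (hr.trans_le (h1.trans (h2.trans hgr.1)))
  have hN0 : (0 : ℝ) < numPulls A a (t - 1) ω := by exact_mod_cast hN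
  rw [lt_div_iff₀ hN0] at h3
  rw [div_lt_iff₀ hM] at hNM
  linarith

theorem one_le_numPulls {A : ℕ → Ω → Fin K} (hinit : ∀ (a : Fin K) ω, A ((a : ℕ) + 1) ω = a)
    (a : Fin K) {t : ℕ} (ht : K ≤ t) (ω : Ω) : 1 ≤ numPulls A a t ω :=
  Finset.card_pos.2 ⟨(a : ℕ) + 1, by
    have := a.2
    simp [hinit]; omega⟩

open Classical in
/-- Pathwise bound of the number of pulls of a suboptimal arm. -/
theorem numPulls_le_of_isUCB [MeasurableSpace E] {d : I → I → EReal} (hd : IsStrongSemiDistance d)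
    (hkl : IsKLDominated d) (hmax : HasUpperConfidenceBounds d) {U : Ω → E}
    {X : Fin K → ℕ → Ω → I} {A : ℕ → Ω → Fin K} (hA : IsUCB d 3 U X A) {a b : Fin K} (hab : a ≠ b)
    {q r : I} {M : ℝ} (hM : 0 < M) (hrq : r ≤ q) (hr : (M : EReal) < d r q) {T : ℕ} (hT : 3 ≤ T)
    (ω : Ω) :
    (numPulls A a T ω : ℝ) ≤ K + explorationRate T / M
      + ((Finset.Icc 1 T).filter
          fun s : ℕ => (r : ℝ) < (∑ i ∈ Finset.range s, (X a i ω : ℝ)) / s).card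
      + ((Finset.Icc 1 T).filter fun t => ω ∈ underestimation X b q t).card := by
  -- Two distinct arms force every `t > K` to be at least 3, where the exploration rate is positive
  -- and monotone.
  have hK : 2 ≤ K := by
    have h1 := a.2
    have h2 := b.2
    have h3 : (a : ℕ) ≠ b := fun h => hab (Fin.ext h)
    omega
  have hfT : 0 ≤ explorationRate T / M := div_nonneg (by linarith [one_lt_explorationRate hT]) hM.le
  set F := (Finset.Icc (K + 1) T).filter fun t => A t ω = a ∧ ω ∉ underestimation X b q t with hF
  set G := (Finset.Icc 1 T).filter
    fun s : ℕ => (r : ℝ) < (∑ i ∈ Finset.range s, (X a i ω : ℝ)) / s with hG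
  set H := (Finset.Icc 1 T).filter fun t => ω ∈ underestimation X b q t with hH
  have hsub : (Finset.Icc 1 T).filter (fun s => A s ω = a) ⊆ (Finset.Icc 1 K ∪ F) ∪ H := by
    intro t ht
    simp only [hF, hH, Finset.mem_union, Finset.mem_filter, Finset.mem_Icc] at ht ⊢
    by_cases hu : ω ∈ underestimation X b q t
    · exact Or.inr ⟨ht.1, hu⟩
    · rcases le_or_gt t K with htK | htK
      · exact Or.inl (Or.inl ⟨ht.1.1, htK⟩)
      · exact Or.inl (Or.inr ⟨⟨htK, ht.1.2⟩, ht.2, hu⟩)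
  have hcard : numPulls A a T ω ≤ K + F.card + H.card := by
    refine (Finset.card_le_card hsub).trans ((Finset.card_union_le _ _).trans ?_)
    gcongr
    exact (Finset.card_union_le _ _).trans (by simp)
  have hFcard : F.card ≤ (Finset.Icc 1 ⌊explorationRate T / M⌋₊ ∪ G).card := by
    -- Times at which `a` is pulled are counted through the preceding pull count, which is injective
    -- on them because every pull increases it.
    refine Finset.card_le_card_of_injOn (fun t => numPulls A a (t - 1) ω) ?_ ?_
    · intro t ht
      simp only [hF, Finset.coe_filter, Finset.mem_Icc, Set.mem_ofPred_eq] at ht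
      obtain ⟨⟨htK, htT⟩, hAt, hu⟩ := ht
      have ht3 : 3 ≤ t := by omega
      have hNa := one_le_numPulls hA.init a (t := t - 1) (by omega) ω
      have hNb := one_le_numPulls hA.init b (t := t - 1) (by omega) ω
      have hub : (q : ℝ) ≤ ucbIndex d 3 X A b t ω := by
        by_contra! hlt
        exact hu (mem_underestimation_of_ucbIndex_lt hd hkl hmax hNb ht3 hlt)
      have hua := hub.trans (hA.argmax t (by omega) ω b)
      rw [hAt] at hua
      have hle := explorationRate_mono ht3 htT
      have hNT : numPulls A a (t - 1) ω ≤ T := (numPulls_le A a _ ω).trans (by omega)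
      simp only [hG, Finset.coe_union, Finset.coe_Icc, Finset.coe_filter, Finset.mem_Icc,
        Set.mem_union, Set.mem_Icc, Set.mem_ofPred_eq]
      rcases mean_ge_or_of_le_ucbIndex hd hmax hM hrq hr hNa ht3 hua with h | h
      · refine Or.inr ⟨⟨hNa, hNT⟩, ?_⟩
        rw [← coe_empMean]; exact h
      · exact Or.inl ⟨hNa, Nat.le_floor (h.trans (by gcongr))⟩
    · intro t ht t' ht' heq
      simp only [hF, Finset.coe_filter, Finset.mem_Icc, Set.mem_ofPred_eq] at ht ht'
      have key : ∀ {u v : ℕ}, 1 ≤ u → A u ω = a → u < v →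
          numPulls A a (u - 1) ω < numPulls A a (v - 1) ω := by
        intro u v hu hAu huv
        have h1 := numPulls_succ A a (u - 1) ω
        rw [Nat.sub_add_cancel hu, if_pos hAu] at h1
        have h2 := numPulls_mono A a ω (by omega : u ≤ v - 1)
        simp only at h2
        omega
      simp only at heq
      rcases lt_trichotomy t t' with h | h | h
      · have := key (by omega) ht.2.1 h; omega
      · exact h
      · have := key (by omega) ht'.2.1 h; omega
  have hfloor : ((Finset.Icc 1 ⌊explorationRate T / M⌋₊ ∪ G).card : ℝ)
      ≤ explorationRate T / M + G.card := by
    have h1 : (Finset.Icc 1 ⌊explorationRate T / M⌋₊ ∪ G).card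
        ≤ ⌊explorationRate T / M⌋₊ + G.card := (Finset.card_union_le _ _).trans (by simp)
    have h2 : ((Finset.Icc 1 ⌊explorationRate T / M⌋₊ ∪ G).card : ℝ)
        ≤ (⌊explorationRate T / M⌋₊ : ℝ) + G.card := by exact_mod_cast h1
    linarith [Nat.floor_le hfT]
  have h1 : (numPulls A a T ω : ℝ) ≤ K + F.card + H.card := by exact_mod_cast hcard
  have h2 : (F.card : ℝ) ≤ ((Finset.Icc 1 ⌊explorationRate T / M⌋₊ ∪ G).card : ℝ) := by
    exact_mod_cast hFcard
  linarith

end UCB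

/-! ### Expected pull counts and their asymptotics. -/

section Regret

variable {Ω E : Type*} [MeasurableSpace Ω] [MeasurableSpace E] {P : Measure Ω}
  {K : ℕ} {ν : Fin K → Measure I} {U : Ω → E} {X : Fin K → ℕ → Ω → I} {A : ℕ → Ω → Fin K}

theorem measurable_coe_reward (hX : IsBanditEnvironment P ν U X) (a : Fin K) (i : ℕ) :
    Measurable fun ω => (X a i ω : ℝ) :=
  measurable_subtype_coe.comp (hX.measurable_reward a i)

theorem iIndepFun_coe_reward (hX : IsBanditEnvironment P ν U X) (a : Fin K) :
    iIndepFun (fun i ω => (X a i ω : ℝ)) P :=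
  (hX.indep.precomp (g := fun i : ℕ => (a, i)) (Prod.mk_right_injective a)).comp
    (fun _ x => (x : ℝ)) fun _ => measurable_subtype_coe

theorem measurable_mean (hX : IsBanditEnvironment P ν U X) (a : Fin K) (s : ℕ) :
    Measurable fun ω => (∑ i ∈ Finset.range s, (X a i ω : ℝ)) / s :=
  (Finset.measurable_sum _ fun i _ => measurable_coe_reward hX a i).div_const _

theorem measurableSet_underestimation (hX : IsBanditEnvironment P ν U X) (b : Fin K) (q : ℝ)
    (t : ℕ) : MeasurableSet (underestimation X b q t) := by
  have : underestimation X b q t = ⋃ s ∈ Finset.Icc 1 t,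
      {ω | (∑ i ∈ Finset.range s, (X b i ω : ℝ)) / s < q} ∩ ({_ω | q = 1} ∪ {ω | explorationRate t
        < s * klReal ((∑ i ∈ Finset.range s, (X b i ω : ℝ)) / s) q}) := by
    ext ω; simp [underestimation, and_left_comm]
  rw [this]
  refine Finset.measurableSet_biUnion _ fun s _ => MeasurableSet.inter ?_ (MeasurableSet.union ?_ ?_)
  · exact measurableSet_lt (measurable_mean hX b s) measurable_const
  · exact MeasurableSet.const _
  · exact measurableSet_lt measurable_const
      (((measurable_klReal q).comp (measurable_mean hX b s)).const_mul _)

variable [IsProbabilityMeasure P]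

/-- Bound in expectation for the number of pulls of a suboptimal arm. -/
theorem integral_numPulls_le {d : I → I → EReal} (hd : IsStrongSemiDistance d)
    (hkl : IsKLDominated d) (hmax : HasUpperConfidenceBounds d)
    (hX : IsBanditEnvironment P ν U X) (hA : IsUCB d 3 U X A) {a b : Fin K} (hab : a ≠ b)
    {q r : I} {M : ℝ} (hM : 0 < M) (hrq : r ≤ q) (hr : (M : EReal) < d r q) {T : ℕ} (hT : 3 ≤ T) :
    ∫ ω, (numPulls A a T ω : ℝ) ∂P ≤ K + explorationRate T / M
      + ∑ s ∈ Finset.Icc 1 T, P.real {ω | (r : ℝ) < (∑ i ∈ Finset.range s, (X a i ω : ℝ)) / s}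
      + ∑ t ∈ Finset.Icc 1 T, P.real (underestimation X b q t) := by
  classical
  have hcard : ∀ (S : ℕ → Set Ω) (ω : Ω), (((Finset.Icc 1 T).filter fun s => ω ∈ S s).card : ℝ)
      = ∑ s ∈ Finset.Icc 1 T, (S s).indicator (fun _ => (1 : ℝ)) ω := fun S ω => by
    rw [Finset.card_filter]; push_cast; rfl
  have hint : ∀ S : ℕ → Set Ω, (∀ s, MeasurableSet (S s)) →
      Integrable (fun ω => ∑ s ∈ Finset.Icc 1 T, (S s).indicator (fun _ => (1 : ℝ)) ω) P :=
    fun S hS => integrable_finsetSum _ fun s _ => (integrable_const _).indicator (hS s)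
  have hval : ∀ S : ℕ → Set Ω, (∀ s, MeasurableSet (S s)) →
      ∫ ω, ∑ s ∈ Finset.Icc 1 T, (S s).indicator (fun _ => (1 : ℝ)) ω ∂P
        = ∑ s ∈ Finset.Icc 1 T, P.real (S s) := fun S hS => by
    rw [integral_finsetSum _ fun s _ => (integrable_const _).indicator (hS s)]
    simp [integral_indicator_const, hS]
  set V : ℕ → Set Ω := fun s => {ω | (r : ℝ) < (∑ i ∈ Finset.range s, (X a i ω : ℝ)) / s} with hV
  have hVm : ∀ s, MeasurableSet (V s) := fun s =>
    measurableSet_lt measurable_const (measurable_mean hX a s)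
  have hWm := measurableSet_underestimation hX b q
  calc ∫ ω, (numPulls A a T ω : ℝ) ∂P
      ≤ ∫ ω, ((K + explorationRate T / M
        + ∑ s ∈ Finset.Icc 1 T, (V s).indicator (fun _ => (1 : ℝ)) ω)
        + ∑ t ∈ Finset.Icc 1 T, (underestimation X b q t).indicator (fun _ => (1 : ℝ)) ω) ∂P := by
        refine integral_mono (integrable_numPulls hX hA.nonanticipating a T)
          (((integrable_const _).add (hint V hVm)).add (hint _ hWm)) fun ω => ?_
        rw [← hcard V ω, ← hcard _ ω]
        convert! numPulls_le_of_isUCB (X := X) hd hkl hmax hA hab hM hrq hr hT ω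
    _ = _ := by
        have h1 : Integrable (fun ω => (K + explorationRate T / M : ℝ)
            + ∑ s ∈ Finset.Icc 1 T, (V s).indicator (fun _ => (1 : ℝ)) ω) P :=
          (integrable_const _).add (hint V hVm)
        rw [integral_add h1 (hint _ hWm), integral_add (integrable_const _) (hint V hVm),
          hval V hVm, hval _ hWm]
        simp [hV]

variable [∀ a, IsProbabilityMeasure (ν a)]

theorem measureReal_underestimation_le (hX : IsBanditEnvironment P ν U X) (b : Fin K) {t : ℕ}
    (ht : 3 ≤ t) : P.real (underestimation X b (armMean (ν b)) t)
      ≤ 5 * Real.exp 1 * (Real.log t)⁻¹ * (t : ℝ)⁻¹ := by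
  refine le_trans ?_ (peeling_bound_le ht)
  have hlog := one_lt_log_of_three_le ht
  have hrate := one_lt_explorationRate ht
  have hnn : 0 ≤ (explorationRate t * Real.log t + 1) * Real.exp (1 - explorationRate t) := by
    positivity
  set q := armMean (ν b) with hq
  have hmean := fun i => integral_reward_eq hX b i
  -- The deviation bound needs `0 < q < 1`. Mean 1 forces rewards equal to 1 almost surely, and mean
  -- 0 leaves no room below; in both cases the event is null.
  rcases eq_or_lt_of_le q.2.2 with h1 | h1
  · have hone : ∀ i, ∀ᵐ ω ∂P, (X b i ω : ℝ) = 1 := fun i => by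
      have hint : Integrable (fun ω => (X b i ω : ℝ)) P :=
        Integrable.of_mem_Icc 0 1 (measurable_coe_reward hX b i).aemeasurable
          (ae_of_all _ fun ω => (X b i ω).2)
      have h0 : ∫ ω, (1 - (X b i ω : ℝ)) ∂P = 0 := by
        rw [integral_sub (integrable_const _) hint, hmean i, ← hq, h1]; simp
      have := (integral_eq_zero_iff_of_nonneg (fun ω => sub_nonneg.2 (X b i ω).2.2)
        ((integrable_const _).sub hint)).1 h0
      filter_upwards [this] with ω hω
      simp only [Pi.zero_apply] at hω
      linarith
    have hzero : P.real (underestimation X b q t) = 0 := by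
      rw [measureReal_eq_zero_iff, measure_eq_zero_iff_ae_notMem]
      filter_upwards [ae_all_iff.2 hone] with ω hω
      rintro ⟨s, hs, hlt, -⟩
      have hs0 : (s : ℝ) ≠ 0 := by
        have := (Finset.mem_Icc.1 hs).1
        exact_mod_cast (by omega : s ≠ 0)
      simp [hω, h1, hs0] at hlt
    rw [hzero]; exact hnn
  rcases eq_or_lt_of_le q.2.1 with h0 | h0
  · have hempty : underestimation X b q t = ∅ := by
      refine Set.eq_empty_of_forall_notMem fun ω => ?_
      rintro ⟨s, -, hlt, -⟩
      rw [← h0] at hlt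
      exact absurd hlt (not_lt.2 (div_nonneg (Finset.sum_nonneg fun i _ => (X b i ω).2.1)
        (Nat.cast_nonneg _)))
    rw [hempty]; simpa using hnn
  · refine le_trans (measureReal_mono ?_) (measure_exists_klReal_gt_le
      (measurable_coe_reward hX b) (fun i ω => (X b i ω).2) (iIndepFun_coe_reward hX b) hmean h0 h1
      hrate (by omega : 1 ≤ t))
    rintro ω ⟨s, hs, hlt, h⟩
    exact ⟨s, hs, hlt, h.resolve_left h1.ne⟩

theorem sum_range_inv_isBigO_log :
    (fun T : ℕ => ∑ t ∈ Finset.range T, ((t + 1 : ℕ) : ℝ)⁻¹) =O[atTop] fun T : ℕ => Real.log T := by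
  refine Asymptotics.IsBigO.of_bound 2 ?_
  filter_upwards [eventually_ge_atTop 3] with T hT
  have h1 := one_lt_log_of_three_le hT
  have h2 := harmonic_le_one_add_log T
  have h3 : ((harmonic T : ℚ) : ℝ) = ∑ t ∈ Finset.range T, ((t + 1 : ℕ) : ℝ)⁻¹ := by
    rw [harmonic]; push_cast; rfl
  rw [h3] at h2
  rw [Real.norm_of_nonneg (Finset.sum_nonneg fun t _ => by positivity),
    Real.norm_of_nonneg (by linarith)]
  linarith

theorem tendsto_log_natCast_atTop : Tendsto (fun T : ℕ => Real.log T) atTop atTop :=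
  Real.tendsto_log_atTop.comp tendsto_natCast_atTop_atTop

/-- The terms are `o(1/t)`, and the harmonic series diverges like `log T`, so their partial sums are
`o(log T)`. -/
theorem sum_underestimation_isLittleO_log (hX : IsBanditEnvironment P ν U X) (b : Fin K) :
    (fun T : ℕ => ∑ t ∈ Finset.Icc 1 T, P.real (underestimation X b (armMean (ν b)) t))
      =o[atTop] fun T : ℕ => Real.log T := by
  have hshift : ∀ T : ℕ, ∑ t ∈ Finset.Icc 1 T, P.real (underestimation X b (armMean (ν b)) t)
      = ∑ t ∈ Finset.range T, P.real (underestimation X b (armMean (ν b)) (t + 1)) := fun T => by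
    rw [Finset.range_eq_Ico, Finset.sum_Ico_add' fun t =>
      P.real (underestimation X b (armMean (ν b)) t)]
    exact Finset.sum_congr (by ext; simp) fun _ _ => rfl
  simp_rw [hshift]
  refine Asymptotics.IsLittleO.trans_isBigO ?_ sum_range_inv_isBigO_log
  refine Asymptotics.IsLittleO.sum_range ?_ (fun t => by positivity) ?_
  · have hlim : Tendsto (fun t : ℕ => 5 * Real.exp 1 * (Real.log (t + 1 : ℕ))⁻¹) atTop
        (nhds 0) := by
      have := (tendsto_log_natCast_atTop.comp (tendsto_add_atTop_nat 1)).inv_tendsto_atTop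
      simpa using this.const_mul (5 * Real.exp 1)
    have h1 : (fun t : ℕ => 5 * Real.exp 1 * (Real.log (t + 1 : ℕ))⁻¹ * ((t + 1 : ℕ) : ℝ)⁻¹)
        =o[atTop] fun t : ℕ => ((t + 1 : ℕ) : ℝ)⁻¹ := by
      simpa using ((Asymptotics.isLittleO_one_iff ℝ).2 hlim).mul_isBigO
        (Asymptotics.isBigO_refl (fun t : ℕ => ((t + 1 : ℕ) : ℝ)⁻¹) atTop)
    refine Asymptotics.IsBigO.trans_isLittleO (Asymptotics.IsBigO.of_bound' ?_) h1
    filter_upwards [eventually_ge_atTop 2] with t ht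
    rw [Real.norm_of_nonneg measureReal_nonneg]
    exact (measureReal_underestimation_le hX b (by omega)).trans (le_abs_self _)
  · refine Real.tendsto_sum_range_one_div_nat_succ_atTop.congr fun T => ?_
    simp

theorem exists_between_lt_of_continuousWithinAt {d : I → I → EReal} {p q : I} (hpq : p < q)
    (hcont : ContinuousWithinAt (fun p => d p q) (Set.Ici p) p) {M : ℝ} (hM : (M : EReal) < d p q) :
    ∃ r, p < r ∧ r ≤ q ∧ (M : EReal) < d r q := by
  have h1 : ∀ᶠ r in nhdsWithin p (Set.Ioi p), (M : EReal) < d r q :=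
    (hcont.mono Set.Ioi_subset_Ici_self).eventually_const_lt hM
  have h2 : ∀ᶠ r in nhdsWithin p (Set.Ioi p), r ≤ q :=
    eventually_nhdsWithin_of_eventually_nhds (eventually_le_nhds hpq)
  have : (nhdsWithin p (Set.Ioi p)).NeBot := nhdsGT_neBot_of_exists_gt ⟨q, hpq⟩
  obtain ⟨r, ⟨hr1, hr2⟩, hr3⟩ := ((h1.and h2).and self_mem_nhdsWithin).exists
  exact ⟨r, hr3, hr2, hr1⟩

/-- Of the four terms in `integral_numPulls_le`, only `log T / M` survives division by `log T`; `ε`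
absorbs `K`, the Hoeffding sum, `log log T` and the underestimation sum. -/
theorem eventually_integral_numPulls_le {d : I → I → EReal} (hd : IsStrongSemiDistance d)
    (hkl : IsKLDominated d) (hmax : HasUpperConfidenceBounds d)
    (hX : IsBanditEnvironment P ν U X) (hA : IsUCB d 3 U X A) {a b : Fin K}
    (hab : armMean (ν a) < armMean (ν b))
    (hcont : ContinuousWithinAt (fun p => d p (armMean (ν b))) (Set.Ici (armMean (ν a)))
      (armMean (ν a)))
    {M : ℝ} (hM : 0 < M) (hMd : (M : EReal) < d (armMean (ν a)) (armMean (ν b)))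
    {ε : ℝ} (hε : 0 < ε) :
    ∀ᶠ T : ℕ in atTop, ∫ ω, (numPulls A a T ω : ℝ) ∂P ≤ (1 / M + ε) * Real.log T := by
  have hne : a ≠ b := by
    rintro rfl
    exact lt_irrefl _ hab
  obtain ⟨r, har, hrb, hr⟩ := exists_between_lt_of_continuousWithinAt hab hcont hMd
  have hsum := summable_measure_mean_gt (P := P) (measurable_coe_reward hX a)
    (fun i ω => (X a i ω).2) (iIndepFun_coe_reward hX a) (integral_reward_eq hX a)
    (r := r) har
  set C := ∑' s : ℕ, P.real {ω | (r : ℝ) < (∑ i ∈ Finset.range s, (X a i ω : ℝ)) / s} with hC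
  have hconst : (fun _ : ℕ => (K + C : ℝ)) =o[atTop] fun T : ℕ => Real.log T :=
    Asymptotics.isLittleO_const_left.2 (Or.inr
      (tendsto_norm_atTop_atTop.comp tendsto_log_natCast_atTop))
  have hloglog : (fun T : ℕ => 3 / M * Real.log (Real.log T)) =o[atTop]
      fun T : ℕ => Real.log T :=
    (Real.isLittleO_log_id_atTop.comp_tendsto tendsto_log_natCast_atTop).const_mul_left _
  have hrest := (hconst.add hloglog).add (sum_underestimation_isLittleO_log hX b)
  filter_upwards [hrest.bound hε, eventually_ge_atTop 3] with T hT hT3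
  have h1 := one_lt_log_of_three_le hT3
  have h2 := integral_numPulls_le (X := X) hd hkl hmax hX hA hne hM hrb hr hT3
  have h3 := hsum.sum_le_tsum (Finset.Icc 1 T) fun _ _ => measureReal_nonneg
  rw [← hC] at h3
  rw [Real.norm_of_nonneg (by linarith : 0 ≤ Real.log T)] at hT
  have h4 := (le_abs_self _).trans hT
  have h5 : explorationRate T / M = 1 / M * Real.log T + 3 / M * Real.log (Real.log T) := by
    rw [explorationRate]; ring
  rw [h5] at h2
  linarith

/-- This treats finite and infinite divergence alike: `M` is chosen with `D / M = ρ + ε`, so it lies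
strictly below `x` and approaches it as `ε` tends to `0`, with `ρ = 0` when `x = ⊤`. -/
theorem exists_coe_div {x : EReal} (hx : 0 < x) {D : ℝ} (hD : 0 < D) :
    ∃ ρ : ℝ, (D : EReal) / x = ρ ∧ ∀ ε : ℝ, 0 < ε →
      ∃ M : ℝ, 0 < M ∧ (M : EReal) < x ∧ D * (1 / M) ≤ ρ + ε := by
  induction x with
  | bot => simp at hx
  | top =>
    refine ⟨0, by simp, fun ε hε => ⟨D / ε, by positivity, EReal.coe_lt_top _, ?_⟩⟩
    field_simp; simp
  | coe x =>
    have hx' : 0 < x := by exact_mod_cast hx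
    refine ⟨D / x, (EReal.coe_div _ _).symm, fun ε hε => ⟨D / (D / x + ε), by positivity, ?_, ?_⟩⟩
    · rw [EReal.coe_lt_coe_iff, div_lt_iff₀ (by positivity), mul_add, mul_div_cancel₀ _ hx'.ne']
      nlinarith
    · field_simp; simp

theorem exists_armMean_eq_bestMean (hK : 0 < K) (ν : Fin K → Measure I)
    [∀ a, IsProbabilityMeasure (ν a)] : ∃ b, armMean (ν b) = bestMean ν := by
  have : Nonempty (Fin K) := ⟨⟨0, hK⟩⟩
  obtain ⟨b, -, hb⟩ := Finset.exists_mem_eq_sup Finset.univ Finset.univ_nonempty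
    fun a => armMean (ν a)
  exact ⟨b, hb.symm⟩

theorem armMean_le_bestMean (ν : Fin K → Measure I) [∀ a, IsProbabilityMeasure (ν a)] (a : Fin K) :
    armMean (ν a) ≤ bestMean ν :=
  Finset.le_sup (f := fun a => armMean (ν a)) (Finset.mem_univ a)

end Regret

theorem theorem1 {Ω E : Type*} [MeasurableSpace Ω] [MeasurableSpace E]
    (P : Measure Ω) [IsProbabilityMeasure P] {K : ℕ} (hK : 0 < K)
    (ν : Fin K → Measure I) [∀ a, IsProbabilityMeasure (ν a)]
    (d : I → I → EReal) (hd : IsStrongSemiDistance d) (hkl : IsKLDominated d)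
    (hmax : HasUpperConfidenceBounds d)
    (hcont : ∀ a, armMean (ν a) < bestMean ν →
      ContinuousWithinAt (fun p => d p (bestMean ν)) (Set.Ici (armMean (ν a))) (armMean (ν a)))
    (U : Ω → E) (X : Fin K → ℕ → Ω → I) (A : ℕ → Ω → Fin K)
    (hX : IsBanditEnvironment P ν U X) (hA : IsUCB d 3 U X A) :
    limsup (fun T : ℕ => ((regret P ν X A T / Real.log T : ℝ) : EReal)) atTop
      ≤ ∑ a : Fin K with armMean (ν a) < bestMean ν,
          (((bestMean ν : ℝ) - (armMean (ν a) : ℝ) : ℝ) : EReal)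
            / d (armMean (ν a)) (bestMean ν) := by
  obtain ⟨b, hb⟩ := exists_armMean_eq_bestMean hK ν
  set S := Finset.univ.filter fun a : Fin K => armMean (ν a) < bestMean ν with hS
  have hgap : ∀ a, ∃ ρ : ℝ, a ∈ S →
      (((bestMean ν : ℝ) - (armMean (ν a) : ℝ) : ℝ) : EReal) / d (armMean (ν a)) (bestMean ν) = ρ ∧
      ∀ ε : ℝ, 0 < ε → ∀ᶠ T : ℕ in atTop, ((bestMean ν : ℝ) - (armMean (ν a) : ℝ))
        * ∫ ω, (numPulls A a T ω : ℝ) ∂P ≤ (ρ + ε) * Real.log T := by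
    intro a
    by_cases ha : a ∈ S
    swap
    · exact ⟨0, fun h => absurd h ha⟩
    have hlt : armMean (ν a) < bestMean ν := (Finset.mem_filter.1 ha).2
    have hD : 0 < (bestMean ν : ℝ) - (armMean (ν a) : ℝ) := sub_pos.2 hlt
    have hdpos : 0 < d (armMean (ν a)) (bestMean ν) :=
      lt_of_le_of_ne (hd.nonneg _ _) fun h => hlt.ne ((hd.eq_zero_iff _ _).1 h.symm)
    obtain ⟨ρ, hρ, hM⟩ := exists_coe_div hdpos hD
    refine ⟨ρ, fun _ => ⟨hρ, fun ε hε => ?_⟩⟩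
    obtain ⟨M, hM0, hMd, hMρ⟩ := hM (ε / 2) (by positivity)
    set D := (bestMean ν : ℝ) - (armMean (ν a) : ℝ) with hDdef
    have hc := hcont a hlt
    rw [← hb] at hlt hc hMd
    filter_upwards [eventually_integral_numPulls_le hd hkl hmax hX hA hlt hc hM0 hMd
      (ε := ε / 2 / D) (by positivity), eventually_ge_atTop 3] with T hT hT3
    have h1 := one_lt_log_of_three_le hT3
    calc D * ∫ ω, (numPulls A a T ω : ℝ) ∂P
        ≤ D * ((1 / M + ε / 2 / D) * Real.log T) := by gcongr
      _ = (D * (1 / M) + ε / 2) * Real.log T := by field_simp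
      _ ≤ (ρ + ε) * Real.log T :=
        mul_le_mul_of_nonneg_right (by linarith) (by linarith)
  choose ρ hρ using hgap
  have hsum : ∑ a ∈ S, (((bestMean ν : ℝ) - (armMean (ν a) : ℝ) : ℝ) : EReal)
      / d (armMean (ν a)) (bestMean ν) = ((∑ a ∈ S, ρ a : ℝ) : EReal) := by
    rw [Finset.sum_congr rfl fun a ha => (hρ a ha).1]
    exact (map_sum (⟨⟨Real.toEReal, EReal.coe_zero⟩, EReal.coe_add⟩ : ℝ →+ EReal) ρ S).symm
  rw [hsum, ← EReal.le_of_forall_lt_iff_le]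
  intro z hz
  have hz' : 0 < z - ∑ a ∈ S, ρ a := sub_pos.2 (EReal.coe_lt_coe_iff.1 hz)
  -- The slack is shared equally among all `K` arms, which covers the at most `K` suboptimal ones.
  set ε := (z - ∑ a ∈ S, ρ a) / K with hε
  have hK0 : (0 : ℝ) < K := by exact_mod_cast hK
  have hε0 : 0 < ε := by positivity
  refine limsup_le_of_le (h := ?_)
  have hall : ∀ᶠ T : ℕ in atTop, ∀ a ∈ S, ((bestMean ν : ℝ) - (armMean (ν a) : ℝ))
        * ∫ ω, (numPulls A a T ω : ℝ) ∂P ≤ (ρ a + ε) * Real.log T :=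
    (Finset.eventually_all S).2 fun a ha => (hρ a ha).2 ε hε0
  filter_upwards [hall, eventually_ge_atTop 3] with T hT hT3
  have h1 := one_lt_log_of_three_le hT3
  rw [EReal.coe_le_coe_iff, div_le_iff₀ (by linarith), regret_eq hX hA.nonanticipating,
    ← Finset.sum_subset (Finset.subset_univ S)]
  · have hcard : (S.card : ℝ) ≤ K := by
      exact_mod_cast (Finset.card_le_univ S).trans_eq (Fintype.card_fin K)
    calc _ ≤ ∑ a ∈ S, (ρ a + ε) * Real.log T := Finset.sum_le_sum hT
      _ = (∑ a ∈ S, ρ a + S.card * ε) * Real.log T := by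
        rw [← Finset.sum_mul, Finset.sum_add_distrib, Finset.sum_const, nsmul_eq_mul]
      _ ≤ (∑ a ∈ S, ρ a + K * ε) * Real.log T := by gcongr
      _ = z * Real.log T := by rw [hε]; field_simp; ring
  · intro a _ ha
    have : armMean (ν a) = bestMean ν := by
      refine (armMean_le_bestMean ν a).antisymm (not_lt.1 fun h => ha ?_)
      exact Finset.mem_filter.2 ⟨Finset.mem_univ a, h⟩
    rw [this]; simp
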